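/- For $\tau>0$, $\sigma>1$ put $M_0=1$ and $M_p=p^{\tau p^\sigma}$ ($p\ge 1$). Let $\mathcal E_{\{\tau,\sigma\}}(\mathbb R^d)$ be the set of $\varphi\in C^\infty(\mathbb R^d)$ such that for every compact $K\subset\mathbb R^d$ there are $h,C>0$ with $|\partial^\alpha\varphi(x)|\le C h^{|\alpha|^\sigma}M_{|\alpha|}$ for all $x\in K$, $\alpha\in\mathbb N_0^d$, and let $\mathcal D_{\{\tau,\sigma\}}(\mathbb R^d)$ be the set of its compactly supported elements. A conic neighborhood of $\xi_0\ne0$ is a neighborhood $\Gamma_0\subset\mathbb R^d\setminus\{0\}$ of $\xi_0$ that is invariant under multiplication by positive reals. For $u\in\mathcal D'(\mathbb R^d)$ and $(x_0,\xi_0)\in\mathbb R^d\times(\mathbb R^d\setminus\{0\})$ we write $(x_0,\xi_0)\notin \mathrm{WF}_{\{\tau,\sigma\}}(u)$ if there are a conic neighborhood $\Gamma_0$ of $\xi_0$, a function $\phi\in\mathcal D_{\{\tau,\sigma\}}(\mathbb R^d)$ with $\phi(x_0)\neq0$, and $h,C>0$ such that $$|\widehat{\phi u}(\xi)|\le C\,\frac{h^{N^\sigma}N^{\tau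 N^\sigma}}{|\xi|^N},\qquad N=1,2,\dots,\ \xi\in\Gamma_0,$$ where $\widehat{\phi u}(\xi)=(u,\phi\, e^{-2\pi i\langle\cdot,\xi\rangle})$. For $g\in C_0^\infty(\mathbb R^d)$ let $$V_gu(x,\xi)=\bigl(u,\ e^{-2\pi i\langle\cdot,\xi\rangle}\,\overline{g(\cdot-x)}\bigr)$$ be the short-time Fourier transform of $u$ with window $g$. Let $W:[0,\infty)\to[0,\infty)$ be the (principal branch of the) Lambert function, i.e. the inverse of $y\mapsto ye^y$. **Corollary.** Let $\sigma>1$. There is a constant $c>0$ depending only on $\sigma$ such that for all $d$, all $u\in\mathcal D'(\mathbb R^d)$, all $\tau>0$ and all $(x_0,\xi_0)\in\mathbb R^d\times(\mathbb R^d\setminus\{0\})$ the following holds. (i) If $(x_0,\xi_0)\notin \mathrm{WF}_{\{\tau,\sigma\}}(u)$, then there exist a conic neighborhood $\Gamma_0$ of $\xi_0$, a compact neighborhood $K$ of $x_0$, and $$g\in\mathcal D_{\{\tau,\sigma\}}(\mathbb R^d)\quad\text{with}\quad \operatorname{supp} g=\{y\in\mathbb R^d: y+x_0\in K\},\quad g(0)\ne0,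 \tag{$*$}$$ such that for every $\tau_2>\tau$ there is $C>0$ with $$|V_gu(x,\xi)|\le C\exp\Bigl\{-c\Bigl(\frac{\ln^\sigma|\xi|}{\tau_2\,W(\ln|\xi|)}\Bigr)^{\frac1{\sigma-1}}\Bigr\},\qquad x\in K,\ \xi\in\Gamma_0,\ |\xi|>1.$$ (ii) Conversely, if there exist a conic neighborhood $\Gamma_0$ of $\xi_0$, a compact neighborhood $K$ of $x_0$, a window $g$ satisfying $(*)$, a number $\tau_1$ with $0<\tau_1<\tau$, and $C>0$ such that $$|V_gu(x,\xi)|\le C\exp\Bigl\{-c\Bigl(\frac{\ln^\sigma|\xi|}{\tau_1\,W(\ln|\xi|)}\Bigr)^{\frac1{\sigma-1}}\Bigr\},\qquad x\in K,\ \xi\in\Gamma_0,\ |\xi|>1,$$ then $(x_0,\xi_0)\notin \mathrm{WF}_{\{\tau,\sigma\}}(u)$. -/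

import Mathlib

open Set Topology TopologicalSpace
open scoped Distributions ContDiff InnerProductSpace

noncomputable section

namespace ExtGevrey

/-- Euclidean space `ℝ^d`. -/
abbrev Rd (d : ℕ) : Type := EuclideanSpace ℝ (Fin d)

/-- The space `𝓓(ℝ^d) = C_0^∞(ℝ^d)` of complex valued test functions, with its usual inductive
limit topology. -/
abbrev TestFun (d : ℕ) : Type := TestFunction (⊤ : Opens (Rd d)) ℂ ⊤

/-- The space `𝓓'(ℝ^d)` of distributions: the (complex linear) topological dual of `𝓓(ℝ^d)`. -/
abbrev Distr (d : ℕ) : Type := TestFun d →L[ℂ] ℂ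

/-! ### The Lambert function -/

/-- The Lambert function on `[0, ∞)`: the inverse of `y ↦ y * exp y` on `[0, ∞)`
(it is only used at arguments `x ≥ 0`). -/
def lambertW (x : ℝ) : ℝ := Function.invFunOn (fun y : ℝ => y * Real.exp y) (Ici 0) x

/-- For `x ≥ 0`, `W(x)` is the unique `w ≥ 0` with `w e^w = x`. -/
theorem lambertW_eq_iff {x : ℝ} (hx : 0 ≤ x) (w : ℝ) :
    lambertW x = w ↔ 0 ≤ w ∧ w * Real.exp w = x := by
  have hex : ∃ y ∈ Ici (0 : ℝ), (fun y : ℝ => y * Real.exp y) y = x := by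
    have hc : ContinuousOn (fun y : ℝ => y * Real.exp y) (Icc 0 x) := by fun_prop
    have hmem : x ∈ Icc ((fun y : ℝ => y * Real.exp y) 0) ((fun y : ℝ => y * Real.exp y) x) := by
      refine ⟨by simpa using hx, ?_⟩
      have := Real.one_le_exp hx
      show x ≤ x * Real.exp x
      nlinarith
    obtain ⟨y, hy, hyx⟩ := intermediate_value_Icc hx hc hmem
    exact ⟨y, hy.1, hyx⟩
  have h1 : 0 ≤ lambertW x := Function.invFunOn_mem hex
  have h2 : lambertW x * Real.exp (lambertW x) = x := Function.invFunOn_eq hex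
  have hmono : ∀ a b : ℝ, 0 ≤ a → a < b → a * Real.exp a < b * Real.exp b := fun a b ha hab =>
    mul_lt_mul'' hab (Real.exp_lt_exp.2 hab) ha (Real.exp_pos a).le
  constructor
  · rintro rfl
    exact ⟨h1, h2⟩
  · rintro ⟨h3, h4⟩
    rcases lt_trichotomy (lambertW x) w with h | h | h
    · have := hmono _ _ h1 h
      linarith
    · exact h
    · have := hmono _ _ h3 h
      linarith

/-! ### Extended Gevrey classes -/

/-- The defining sequence `M_p^{τ,σ} = p^{τ p^σ}`. For `σ ≠ 0`, the value at `p = 0` is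
`0 ^ 0 = 1`. -/
def defSeq (τ σ : ℝ) (p : ℕ) : ℝ := (p : ℝ) ^ (τ * (p : ℝ) ^ σ)

/-- The extended Gevrey class `𝓔_{τ,σ}(ℝ^d)` of Roumieu type: smooth functions `φ` such that for
every compact set `K` there are `h, C > 0` with
`|∂^α φ(x)| ≤ C h^{|α|^σ} M_{|α|}^{τ,σ}` for all `x ∈ K` and all multi-indices `α`.
A partial derivative `∂^α` with `|α| = n` is written as `∂_{i_1} ⋯ ∂_{i_n}`. -/
def IsExtGevrey {d : ℕ} (τ σ : ℝ) (φ : Rd d → ℂ) : Prop :=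
  ContDiff ℝ ∞ φ ∧
    ∀ K : Set (Rd d), IsCompact K → ∃ h > (0 : ℝ), ∃ C > (0 : ℝ),
      ∀ x ∈ K, ∀ (n : ℕ) (i : Fin n → Fin d),
        ‖iteratedFDeriv ℝ n φ x (fun k => EuclideanSpace.single (i k) (1 : ℝ))‖ ≤
          C * h ^ ((n : ℝ) ^ σ) * defSeq τ σ n

/-! ### Operations on test functions, and the short-time Fourier transform -/

/-- Modulation: `(M_ξ φ)(t) = exp(2πi t·ξ) φ(t)`. -/
def modulation {d : ℕ} (ξ : Rd d) (φ : TestFun d) : TestFun d where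
  toFun t := Complex.exp (2 * Real.pi * Complex.I * ((inner ℝ t ξ : ℝ) : ℂ)) * φ t
  contDiff' := by
    have h1 : ContDiff ℝ ((⊤ : ℕ∞) : WithTop ℕ∞) (fun t : Rd d => ((inner ℝ t ξ : ℝ) : ℂ)) :=
      Complex.ofRealCLM.contDiff.comp (contDiff_id.inner ℝ contDiff_const)
    exact ((contDiff_const.mul h1).cexp).mul φ.contDiff
  hasCompactSupport' := φ.hasCompactSupport.mul_left
  tsupport_subset' := fun _ _ => trivial

/-- Translation: `(T_x φ)(t) = φ(t - x)`. -/
def translation {d : ℕ} (x : Rd d) (φ : TestFun d) : TestFun d where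
  toFun t := φ (t - x)
  contDiff' := φ.contDiff.comp (contDiff_id.sub contDiff_const)
  hasCompactSupport' := φ.hasCompactSupport.comp_homeomorph (Homeomorph.subRight x)
  tsupport_subset' := fun _ _ => trivial

/-- Complex conjugation of a test function. -/
def conjugate {d : ℕ} (φ : TestFun d) : TestFun d where
  toFun t := (starRingEnd ℂ) (φ t)
  contDiff' := Complex.conjCLE.contDiff.comp φ.contDiff
  hasCompactSupport' := φ.hasCompactSupport.comp_left (map_zero _)
  tsupport_subset' := fun _ _ => trivial

/-- The Fourier transform of the compactly supported distribution `φ u`: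
`(φ u)^(ξ) = (u, φ e^{-2πi ⟨·, ξ⟩})`. -/
def fourierCutoff {d : ℕ} (u : Distr d) (φ : TestFun d) (ξ : Rd d) : ℂ :=
  u (modulation (-ξ) φ)

/-- The short-time Fourier transform
`V_g u (x, ξ) = ⟨u, M_ξ T_x g⟩ = (u, conj (M_ξ T_x g))`; if `u` is a function, this is
`∫ e^{-2πi t·ξ} u(t) conj (g (t - x)) dt`. -/
def stft {d : ℕ} (g : TestFun d) (u : Distr d) (x ξ : Rd d) : ℂ :=
  u (conjugate (modulation ξ (translation x g)))

/-! ### The wave-front set -/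

/-- `Γ ⊆ ℝ^d \ {0}` is a conic neighborhood of `ξ₀`. -/
def IsConicNhd {d : ℕ} (Γ : Set (Rd d)) (ξ₀ : Rd d) : Prop :=
  Γ ∈ 𝓝 ξ₀ ∧ 0 ∉ Γ ∧ ∀ ξ ∈ Γ, ∀ t : ℝ, 0 < t → t • ξ ∈ Γ

/-- The wave-front set `WF_{τ,σ}(u) ⊆ ℝ^d × (ℝ^d \ {0})` of Roumieu type: `(x₀, ξ₀)` with
`ξ₀ ≠ 0` is outside of it iff there are a conic neighborhood `Γ` of `ξ₀` and a compactly supported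
`φ` of class `𝓔_{τ,σ}` with `φ(x₀) ≠ 0` such that, for some `h, C > 0`,
`|(φ u)^(ξ)| ≤ C h^{N^σ} N^{τ N^σ} / |ξ|^N` for all `N = 1, 2, …` and `ξ ∈ Γ`. -/
def waveFrontSet {d : ℕ} (τ σ : ℝ) (u : Distr d) : Set (Rd d × Rd d) :=
  {p | p.2 ≠ 0 ∧
    ¬ ∃ (Γ : Set (Rd d)) (φ : TestFun d),
      IsConicNhd Γ p.2 ∧ IsExtGevrey τ σ φ ∧ φ p.1 ≠ 0 ∧
      ∃ h > (0 : ℝ), ∃ C > (0 : ℝ), ∀ N : ℕ, 1 ≤ N → ∀ ξ ∈ Γ,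
        ‖fourierCutoff u φ ξ‖ ≤ C * (h ^ ((N : ℝ) ^ σ) * defSeq τ σ N / ‖ξ‖ ^ N)}

/-- Admissible windows `g` for the compact set `K` and the point `x₀`: compactly supported
functions of class `𝓔_{τ,σ}` with `supp g = {y | y + x₀ ∈ K}` and `g(0) ≠ 0`. -/
def IsWindow {d : ℕ} (τ σ : ℝ) (x₀ : Rd d) (K : Set (Rd d)) (g : TestFun d) : Prop :=
  IsExtGevrey τ σ g ∧ tsupport g = {y | y + x₀ ∈ K} ∧ g 0 ≠ 0

/-- The decay function `exp(-c (ln^σ r / (τ W(ln r)))^{1/(σ-1)})`, used for `r > 1`. -/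
def lambertDecay (c τ σ r : ℝ) : ℝ :=
  Real.exp (-c * (Real.log r ^ σ / (τ * lambertW (Real.log r))) ^ (1 / (σ - 1)))

end ExtGevrey

end

noncomputable section

namespace ExtGevrey

/-! Write `L = ln r` and `w = W(L)`, so that `w e^w = L`. The exponent of `h^{N^σ} N^{τ N^σ} / r^N`
is `N^σ (τ ln N + ln h) - N L`. To leading order it is smallest at `q = optOrder τ σ w`, where
`q^{σ-1} = (σ-1)/(σ τ) e^w` and `ln q` is `w/(σ-1)` up to a constant. The leading value there is `q
L/σ - q L = -((σ-1)/σ) q L`, which is exactly the exponent of `lambertDecay (decayConst σ) τ σ r`.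
Hence one constant, depending on `σ` alone, serves both implications. In one direction the lower
order terms are absorbed by enlarging `h` (`exists_lambertDecay_le`), in the other by enlarging `τ`
(`exists_le_lambertDecay`). It remains to compare bounds for all `N`.

For (ii), `V_g u(x₀, ·)` is itself the Fourier transform of `u` cut off by `conj g(· - x₀)`, which
is an admissible cutoff.

For (i), let `φ` be the cutoff supplied by the wave-front condition and `g` a small real bump of
Gevrey type. For `x` near `x₀` the quotient `χ = g(· - x)/φ` is of class `{τ,σ}` with constants
independent of `x`: the Leibniz formula for `φ χ = g(· - x)` is a recursion for the derivatives of
`χ`, solved by `exists_le_of_leibniz`. Expanding `χ` in a Fourier series with coefficients `c_k` on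
a cube containing `supp φ` gives `V_g u(x, ξ) = ∑ c_k (φ u)^(ξ - κ_k)` with `κ_k = k/(4ρ)`
(`hasSum_stft`). If `|κ_k| ≤ ε|ξ|`, the frequency `ξ - κ_k` stays in the original cone, where `(φ
u)^` decays. Otherwise `|k|` is at least comparable to `|ξ|`, and the decay of `c_k` beats the
polynomial growth of `(φ u)^` (`exists_lattice_convolution_le`). -/

/-! ### The decay function and the associated function of the defining sequence -/

/-- The optimal constant in the exponent of the decay function. -/
def decayConst (σ : ℝ) : ℝ := ((σ - 1) / σ) ^ (σ / (σ - 1))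

/-- The (real) order at which the infimum over `N` of `N ^ (τ N ^ σ) / r ^ N` is attained up to
lower order terms, as a function of `w = W(ln r)`. -/
def optOrder (τ σ w : ℝ) : ℝ := ((σ - 1) / (σ * τ)) ^ (1 / (σ - 1)) * Real.exp (w / (σ - 1))

theorem decayConst_pos {σ : ℝ} (hσ : 1 < σ) : 0 < decayConst σ := by
  have : 0 < σ - 1 := by linarith
  unfold decayConst
  positivity

theorem optOrder_pos {τ σ : ℝ} (hσ : 1 < σ) (hτ : 0 < τ) (w : ℝ) : 0 < optOrder τ σ w := by
  have : 0 < σ - 1 := by linarith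
  unfold optOrder
  positivity

theorem optOrder_rpow {τ σ : ℝ} (hσ : 1 < σ) (hτ : 0 < τ) (w : ℝ) :
    optOrder τ σ w ^ (σ - 1) = (σ - 1) / (σ * τ) * Real.exp w := by
  have hs : 0 < σ - 1 := by linarith
  unfold optOrder
  rw [Real.mul_rpow (by positivity) (by positivity), ← Real.rpow_mul (by positivity),
    one_div_mul_cancel hs.ne', Real.rpow_one, ← Real.exp_mul, div_mul_cancel₀ _ hs.ne']

theorem log_optOrder {τ σ : ℝ} (hσ : 1 < σ) (hτ : 0 < τ) (w : ℝ) :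
    Real.log (optOrder τ σ w) = 1 / (σ - 1) * Real.log ((σ - 1) / (σ * τ)) + w / (σ - 1) := by
  have hs : 0 < σ - 1 := by linarith
  unfold optOrder
  rw [Real.log_mul (by positivity) (by positivity), Real.log_rpow (by positivity), Real.log_exp]

/-- Since `L = w e^w`, one has `L^σ/(τ w) = L^{σ-1} e^w/τ`. The power `1/(σ-1)` therefore releases
exactly one factor `L`, and the rest is a multiple of `optOrder`. -/
theorem lambertDecay_eq {τ σ r : ℝ} (hσ : 1 < σ) (hτ : 0 < τ) (hr : 1 < r) :
    ∃ w : ℝ, 0 < w ∧ w * Real.exp w = Real.log r ∧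
      lambertDecay (decayConst σ) τ σ r =
        Real.exp (-((σ - 1) / σ * optOrder τ σ w * Real.log r)) := by
  have hs : 0 < σ - 1 := by linarith
  have hL : 0 < Real.log r := Real.log_pos hr
  obtain ⟨h0, h1⟩ := (lambertW_eq_iff hL.le (lambertW (Real.log r))).1 rfl
  set w := lambertW (Real.log r) with hw
  have hwpos : 0 < w := by
    rcases h0.lt_or_eq with h | h
    · exact h
    · rw [← h] at h1; simp at h1; linarith
  refine ⟨w, hwpos, h1, ?_⟩
  unfold lambertDecay
  rw [← hw, ← neg_mul]
  have key : decayConst σ * (Real.log r ^ σ / (τ * w)) ^ (1 / (σ - 1)) =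
      (σ - 1) / σ * optOrder τ σ w * Real.log r := by
    have e1 : Real.log r ^ σ / (τ * w) = Real.log r ^ (σ - 1) * (Real.exp w / τ) := by
      rw [Real.rpow_sub_one hL.ne']
      field_simp
      rw [← h1]
    have e2 : decayConst σ = ((σ - 1) / σ) * ((σ - 1) / σ) ^ (1 / (σ - 1)) := by
      unfold decayConst
      have : σ / (σ - 1) = 1 + 1 / (σ - 1) := by field_simp; ring
      rw [this, Real.rpow_add (by positivity), Real.rpow_one]
    have e3 : (σ - 1) / (σ * τ) = ((σ - 1) / σ) * (1 / τ) := by field_simp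
    unfold optOrder
    rw [e1, e2, e3, Real.mul_rpow (by positivity) (by positivity), ← Real.rpow_mul hL.le,
      mul_one_div_cancel hs.ne', Real.rpow_one, Real.mul_rpow (by positivity) (by positivity),
      div_eq_mul_one_div (Real.exp w), Real.mul_rpow (Real.exp_pos w).le (by positivity),
      ← Real.exp_mul, mul_one_div w]
    ring
  rw [neg_mul, key]
  congr 1
  ring

theorem pow_gevrey_bound_eq {τ σ h r : ℝ} (hh : 0 < h) (hr : 0 < r) {N : ℕ} (hN : 1 ≤ N) :
    h ^ ((N : ℝ) ^ σ) * defSeq τ σ N / r ^ N =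
      Real.exp ((N : ℝ) ^ σ * (τ * Real.log N + Real.log h) - N * Real.log r) := by
  have hN' : (0 : ℝ) < N := by exact_mod_cast hN
  unfold defSeq
  rw [Real.exp_sub, Real.exp_nat_mul, Real.exp_log hr, Real.rpow_def_of_pos hh,
    Real.rpow_def_of_pos hN' (τ * _), ← Real.exp_add]
  congr 2
  ring

/-- The decay function is bounded by every term of the sequence `h^{N^σ} N^{τ N^σ} / r^N`. -/
theorem exists_lambertDecay_le {τ σ : ℝ} (hσ : 1 < σ) (hτ : 0 < τ) :
    ∃ h : ℝ, 1 ≤ h ∧ ∀ N : ℕ, 1 ≤ N → ∀ r : ℝ, 1 < r →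
      lambertDecay (decayConst σ) τ σ r ≤ h ^ ((N : ℝ) ^ σ) * defSeq τ σ N / r ^ N := by
  have hs : 0 < σ - 1 := by linarith
  -- Here `a e^{w/(σ-1)} = ((σ-1)/σ) q`, and `h ≥ a^{-τ}` is what turns failure of the case
  -- condition `hc` below into `N ≤ ((σ-1)/σ) q`.
  set a : ℝ := (σ - 1) / σ * ((σ - 1) / (σ * τ)) ^ (1 / (σ - 1)) with ha
  have hapos : 0 < a := by positivity
  refine ⟨max 1 (a ^ (-τ)), le_max_left _ _, fun N hN r hr => ?_⟩
  set h := max 1 (a ^ (-τ))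
  have hh1 : 1 ≤ h := le_max_left _ _
  have hlogh : 0 ≤ Real.log h := Real.log_nonneg hh1
  have hloga : -τ * Real.log a ≤ Real.log h := by
    rw [← Real.log_rpow hapos]
    exact Real.log_le_log (by positivity) (le_max_right _ _)
  have hN' : (1 : ℝ) ≤ N := by exact_mod_cast hN
  have hlogN : 0 ≤ Real.log N := Real.log_nonneg hN'
  obtain ⟨w, hw, hwL, heq⟩ := lambertDecay_eq hσ hτ hr
  have hL : 0 < Real.log r := Real.log_pos hr
  rw [heq, pow_gevrey_bound_eq (by linarith) (by linarith) hN]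
  apply Real.exp_le_exp.2
  set L := Real.log r
  set q := optOrder τ σ w with hq
  have hqpos : 0 < q := optOrder_pos hσ hτ w
  have hNσ : 0 < (N : ℝ) ^ σ := by positivity
  -- For large `N`, Young's inequality for `N * q^{σ-1}` with exponents `σ` and `σ/(σ-1)`, scaled by
  -- `σ τ w/(σ-1)`, is the claim. For small `N` the term `-N L` suffices alone.
  by_cases hc : τ * (w / (σ - 1)) ≤ τ * Real.log N + Real.log h
  · have young : (N : ℝ) * q ^ (σ - 1) ≤ (N : ℝ) ^ σ / σ + (σ - 1) / σ * q ^ σ := by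
      have hpq : σ.HolderConjugate (σ / (σ - 1)) := Real.HolderConjugate.conjExponent hσ
      have := Real.young_inequality_of_nonneg (a := (N : ℝ)) (b := q ^ (σ - 1)) (by positivity)
        (by positivity) hpq
      rw [← Real.rpow_mul hqpos.le, mul_div_cancel₀ _ hs.ne'] at this
      calc _ ≤ _ := this
        _ = _ := by field_simp
    have hqs := optOrder_rpow hσ hτ w
    rw [← hq] at hqs
    have hqσ : q ^ σ = q * ((σ - 1) / (σ * τ) * Real.exp w) := by
      rw [← hqs, Real.rpow_sub_one hqpos.ne']; field_simp
    rw [hqσ, hqs] at young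
    have y2 := mul_le_mul_of_nonneg_left young (show 0 ≤ σ * τ / (σ - 1) * w by positivity)
    have e1 : σ * τ / (σ - 1) * w * (N * ((σ - 1) / (σ * τ) * Real.exp w)) = N * L := by
      rw [← hwL]; field_simp
    have e2 : σ * τ / (σ - 1) * w * ((N : ℝ) ^ σ / σ + (σ - 1) / σ *
        (q * ((σ - 1) / (σ * τ) * Real.exp w))) =
        (N : ℝ) ^ σ * (τ * (w / (σ - 1))) + (σ - 1) / σ * q * L := by
      rw [← hwL]; field_simp
    rw [e1, e2] at y2
    have := mul_le_mul_of_nonneg_left hc hNσ.le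
    linarith
  · push Not at hc
    have h1 : Real.log N ≤ Real.log (a * Real.exp (w / (σ - 1))) := by
      rw [Real.log_mul hapos.ne' (by positivity), Real.log_exp]
      have : τ * Real.log N < τ * (Real.log a + w / (σ - 1)) := by linarith
      exact (lt_of_mul_lt_mul_left this hτ.le).le
    have h2 : (N : ℝ) ≤ (σ - 1) / σ * q := by
      have := (Real.log_le_log_iff (by linarith) (by positivity)).1 h1
      rw [hq, optOrder, ← mul_assoc]
      exact this
    have h3 := mul_le_mul_of_nonneg_right h2 hL.le
    have h4 : 0 ≤ (N : ℝ) ^ σ * (τ * Real.log N + Real.log h) := by positivity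
    linarith

/-- Up to a constant, the decay function with a larger parameter dominates the infimum of the
sequence `h^{N^σ} N^{τ N^σ} / r^N`. -/
theorem exists_le_lambertDecay {τ τ₂ σ h : ℝ} (hσ : 1 < σ) (hτ : 0 < τ) (hττ : τ < τ₂)
    (hh : 0 < h) :
    ∃ C : ℝ, 0 < C ∧ ∀ r : ℝ, 1 < r → ∃ N : ℕ, 1 ≤ N ∧
      h ^ ((N : ℝ) ^ σ) * defSeq τ σ N / r ^ N ≤ C * lambertDecay (decayConst σ) τ₂ σ r := by
  have hs : 0 < σ - 1 := by linarith
  have hτ₂ : 0 < τ₂ := hτ.trans hττ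
  -- `B` collects the lower order terms: `τ ln q + max 0 (ln h) = τ w/(σ-1) + B`, with `q` formed
  -- from `τ₂`.
  set B : ℝ := τ * (1 / (σ - 1) * Real.log ((σ - 1) / (σ * τ₂))) + max 0 (Real.log h) with hB
  have hqlim : Filter.Tendsto (optOrder τ₂ σ) Filter.atTop Filter.atTop := by
    unfold optOrder
    apply Filter.Tendsto.const_mul_atTop (by positivity)
    exact Real.tendsto_exp_atTop.comp (Filter.tendsto_id.atTop_div_const hs)
  -- Beyond `w₀` the floor of `q` is at least 1, and the gain from `τ₂ - τ` exceeds both the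
  -- rounding loss `L` (second condition) and the contribution of `B` (third).
  obtain ⟨w₀, hw₀⟩ := Filter.eventually_atTop.1 ((hqlim.eventually_ge_atTop 1).and
    ((hqlim.eventually_ge_atTop (2 * σ * τ₂ / (τ₂ - τ))).and
      (Filter.eventually_ge_atTop (2 * (σ - 1) * B / (τ₂ - τ)))))
  have hδ : 0 < τ₂ - τ := by linarith
  set C₀ := (σ - 1) / σ * optOrder τ₂ σ w₀ * (w₀ * Real.exp w₀)
  refine ⟨max 1 (h * Real.exp C₀), lt_max_of_lt_left one_pos, fun r hr => ?_⟩
  obtain ⟨w, hw, hwL, heq⟩ := lambertDecay_eq hσ hτ₂ hr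
  have hL : 0 < Real.log r := Real.log_pos hr
  by_cases hww : w ≤ w₀
  -- For bounded `w` the decay function is bounded below by `exp(-C₀)`, so the term `N = 1` and a
  -- large constant are enough.
  · refine ⟨1, le_rfl, ?_⟩
    have h1 : h ^ (((1 : ℕ) : ℝ) ^ σ) * defSeq τ σ 1 / r ^ 1 ≤ h := by
      simp only [defSeq, Nat.cast_one, Real.one_rpow, Real.rpow_one, mul_one, pow_one]
      exact div_le_self hh.le hr.le
    have h2 : Real.exp (-C₀) ≤ lambertDecay (decayConst σ) τ₂ σ r := by
      rw [heq]
      apply Real.exp_le_exp.2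
      rw [← hwL]
      have : optOrder τ₂ σ w ≤ optOrder τ₂ σ w₀ := by unfold optOrder; gcongr
      have h3 : 0 < optOrder τ₂ σ w := optOrder_pos hσ hτ₂ w
      have : (σ - 1) / σ * optOrder τ₂ σ w * (w * Real.exp w) ≤ C₀ := by
        have h4 : 0 < optOrder τ₂ σ w₀ := optOrder_pos hσ hτ₂ w₀
        have h5 : 0 ≤ w₀ := hw.le.trans hww
        simp only [C₀]
        gcongr
      linarith
    calc _ ≤ h := h1
      _ = h * Real.exp C₀ * Real.exp (-C₀) := by
        rw [mul_assoc, ← Real.exp_add]; simp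
      _ ≤ max 1 (h * Real.exp C₀) * Real.exp (-C₀) := by gcongr; exact le_max_right _ _
      _ ≤ _ := by gcongr
  · push Not at hww
    obtain ⟨hq1, hq2, hwB⟩ := hw₀ w hww.le
    set q := optOrder τ₂ σ w with hq
    have hN : 1 ≤ ⌊q⌋₊ := Nat.le_floor (by simpa using hq1)
    refine ⟨⌊q⌋₊, hN, ?_⟩
    set N := ⌊q⌋₊
    have hNq : (N : ℝ) ≤ q := Nat.floor_le (by linarith)
    have hqN : q - 1 ≤ N := by have := Nat.lt_floor_add_one q; linarith
    have hN' : (1 : ℝ) ≤ N := by exact_mod_cast hN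
    refine le_trans ?_ (le_mul_of_one_le_left (Real.exp_pos _).le (le_max_left _ _))
    rw [heq, pow_gevrey_bound_eq hh (by linarith) hN]
    apply Real.exp_le_exp.2
    have hlq := log_optOrder hσ hτ₂ w
    rw [← hq] at hlq
    set L := Real.log r
    have hqs := optOrder_rpow hσ hτ₂ w
    rw [← hq] at hqs
    have hqpos : 0 < q := by linarith
    have hqσ : q ^ σ = q * ((σ - 1) / (σ * τ₂) * Real.exp w) := by
      rw [← hqs, Real.rpow_sub_one hqpos.ne']; field_simp
    have s1 : (N : ℝ) ^ σ * (τ * Real.log N + Real.log h) ≤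
        q ^ σ * (τ * (w / (σ - 1)) + B) := by
      have : τ * (w / (σ - 1)) + B = τ * Real.log q + max 0 (Real.log h) := by
        rw [hlq, hB]; ring
      rw [this]
      have h0 : 0 ≤ Real.log N := Real.log_nonneg hN'
      have h5 : Real.log N ≤ Real.log q := Real.log_le_log (by linarith) hNq
      calc (N : ℝ) ^ σ * (τ * Real.log N + Real.log h) ≤
          (N : ℝ) ^ σ * (τ * Real.log N + max 0 (Real.log h)) := by gcongr; exact le_max_right _ _
        _ ≤ _ := by
          have : 0 ≤ max 0 (Real.log h) := le_max_left _ _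
          gcongr
    have s2 : q * L - L ≤ N * L := by nlinarith
    have s3 : q ^ σ * (τ₂ * (w / (σ - 1))) = q * L / σ := by
      rw [hqσ, ← hwL]; field_simp
    -- Half of the gain `(τ₂ - τ) w/(σ-1)` pays for `B`; the other half, multiplied by `q^σ`, equals
    -- `q L (τ₂ - τ)/(2 σ τ₂)` and pays for `L`.
    have s4 : L ≤ q ^ σ * ((τ₂ - τ) * (w / (σ - 1)) - B) := by
      have hb : (τ₂ - τ) * w / (2 * (σ - 1)) ≤ (τ₂ - τ) * (w / (σ - 1)) - B := by
        rw [div_le_iff₀ hδ] at hwB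
        have : B ≤ (τ₂ - τ) * w / (2 * (σ - 1)) := by
          rw [le_div_iff₀ (by positivity)]; linarith
        have e : (τ₂ - τ) * (w / (σ - 1)) = 2 * ((τ₂ - τ) * w / (2 * (σ - 1))) := by field_simp
        linarith
      calc L = (2 * σ * τ₂ / (τ₂ - τ)) * ((τ₂ - τ) / (2 * σ * τ₂)) * L := by field_simp
        _ ≤ q * ((τ₂ - τ) / (2 * σ * τ₂)) * L := by gcongr
        _ = q ^ σ * ((τ₂ - τ) * w / (2 * (σ - 1))) := by
          rw [hqσ, ← hwL]; field_simp
        _ ≤ _ := by gcongr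
    have s5 : (σ - 1) / σ * q * L = q * L - q * L / σ := by field_simp
    rw [s5, ← s3]
    linarith

/-! ### The sequences `h^{n^σ} n^{τ n^σ}` -/

theorem defSeq_pos {τ σ : ℝ} (hσ : 1 < σ) (n : ℕ) : 0 < defSeq τ σ n := by
  unfold defSeq
  rcases Nat.eq_zero_or_pos n with rfl | hn
  · have : (0 : ℝ) ^ σ = 0 := Real.zero_rpow (by linarith)
    simp [this]
  · have : (0 : ℝ) < n := by exact_mod_cast hn
    positivity

theorem defSeq_zero {τ σ : ℝ} (hσ : 1 < σ) : defSeq τ σ 0 = 1 := by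
  have : (0 : ℝ) ^ σ = 0 := Real.zero_rpow (by linarith)
  simp [defSeq, this]

theorem defSeq_eq_exp {τ σ : ℝ} {n : ℕ} (hn : 1 ≤ n) :
    defSeq τ σ n = Real.exp (τ * (n : ℝ) ^ σ * Real.log n) := by
  have : (0 : ℝ) < n := by exact_mod_cast hn
  rw [defSeq, Real.rpow_def_of_pos this (τ * _)]
  ring_nf

theorem le_natCast_rpow {σ : ℝ} (hσ : 1 < σ) (n : ℕ) : (n : ℝ) ≤ (n : ℝ) ^ σ := by
  rcases Nat.eq_zero_or_pos n with rfl | hn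
  · simp [Real.zero_rpow (show σ ≠ 0 by linarith)]
  · exact Real.self_le_rpow_of_one_le (by exact_mod_cast hn) hσ.le

theorem defSeq_mono_left {τ₁ τ σ : ℝ} (h : τ₁ ≤ τ) {n : ℕ} (hn : 1 ≤ n) :
    defSeq τ₁ σ n ≤ defSeq τ σ n := by
  have : (1 : ℝ) ≤ n := by exact_mod_cast hn
  unfold defSeq
  gcongr

/-- A factor `n^n` costs `n ln n` in the exponent. This trades it for an arbitrarily small fraction
of `n^σ ln n` and a geometric factor `e^{R n}`: either `t n^{σ-1} ≥ 1`, or `n` is bounded in terms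
of `t`. -/
theorem exists_log_le_add {σ t : ℝ} (hσ : 1 < σ) (ht : 0 < t) :
    ∃ R : ℝ, 0 ≤ R ∧ ∀ n : ℕ, 1 ≤ n →
      Real.log n ≤ R + t * (n : ℝ) ^ (σ - 1) * Real.log n := by
  have hs : 0 < σ - 1 := by linarith
  refine ⟨(1 / t) ^ (1 / (σ - 1)), by positivity, fun n hn => ?_⟩
  have hn' : (1 : ℝ) ≤ n := by exact_mod_cast hn
  have hlog : 0 ≤ Real.log n := Real.log_nonneg hn'
  by_cases h : 1 ≤ t * (n : ℝ) ^ (σ - 1)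
  · have : 0 ≤ (1 / t) ^ (1 / (σ - 1)) := by positivity
    nlinarith
  · push Not at h
    have h1 : (n : ℝ) ^ (σ - 1) ≤ 1 / t := by
      rw [le_div_iff₀ ht]; linarith
    have h2 : (n : ℝ) ≤ (1 / t) ^ (1 / (σ - 1)) := by
      have := Real.rpow_le_rpow (by positivity) h1 (show 0 ≤ 1 / (σ - 1) by positivity)
      rwa [← Real.rpow_mul (by positivity), mul_one_div_cancel hs.ne', Real.rpow_one] at this
    have h3 : Real.log n ≤ n := (Real.log_le_sub_one_of_pos (by linarith)).trans (by linarith)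
    have : 0 ≤ t * (n : ℝ) ^ (σ - 1) * Real.log n := by positivity
    linarith

/-- Gevrey sequences are dominated by every sequence `h^{n^σ} n^{τ n^σ}` with `h` large. -/
theorem exists_pow_mul_pow_le {τ σ : ℝ} (hσ : 1 < σ) (hτ : 0 < τ) (k : ℕ) {A : ℝ} (hA : 1 ≤ A) :
    ∃ h : ℝ, 1 ≤ h ∧ ∀ n : ℕ, (n : ℝ) ^ (k * n) * A ^ n ≤ h ^ ((n : ℝ) ^ σ) * defSeq τ σ n := by
  -- The `k` copies of `n ln n` use the fraction `k/(k+1) ≤ 1` of `τ n^σ ln n`; the `+ 1` also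
  -- covers `k = 0`.
  obtain ⟨R, hR, hRn⟩ := exists_log_le_add hσ (show 0 < τ / (k + 1) by positivity)
  refine ⟨A * Real.exp (k * R), one_le_mul_of_one_le_of_one_le hA
    (Real.one_le_exp (by positivity)), fun n => ?_⟩
  rcases Nat.eq_zero_or_pos n with rfl | hn
  · simp [defSeq_zero hσ, Real.zero_rpow (show σ ≠ 0 by linarith)]
  have hn' : (1 : ℝ) ≤ n := by exact_mod_cast hn
  have hlog : 0 ≤ Real.log n := Real.log_nonneg hn'
  have hlogA : 0 ≤ Real.log A := Real.log_nonneg hA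
  have e1 : (n : ℝ) ^ (k * n) * A ^ n = Real.exp (k * n * Real.log n + n * Real.log A) := by
    rw [Real.exp_add, ← Nat.cast_mul, Real.exp_nat_mul, Real.exp_nat_mul,
      Real.exp_log (by linarith), Real.exp_log (by linarith)]
  have e2 : (A * Real.exp (k * R)) ^ ((n : ℝ) ^ σ) =
      Real.exp ((Real.log A + k * R) * (n : ℝ) ^ σ) := by
    rw [Real.rpow_def_of_pos (by positivity), Real.log_mul (by positivity) (by positivity),
      Real.log_exp]
  rw [e1, e2, defSeq_eq_exp hn, ← Real.exp_add]
  apply Real.exp_le_exp.2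
  have h1 := le_natCast_rpow hσ n
  have h2 := hRn n hn
  have e3 : (n : ℝ) ^ σ = n * (n : ℝ) ^ (σ - 1) := by
    rw [Real.rpow_sub_one (by positivity)]; field_simp
  have h3 : k * n * Real.log n ≤ k * R * n + τ * (n : ℝ) ^ σ * Real.log n := by
    calc k * n * Real.log n ≤ k * n * (R + τ / (k + 1) * (n : ℝ) ^ (σ - 1) * Real.log n) := by
          gcongr
      _ = k * R * n + (k / (k + 1)) * (τ * (n : ℝ) ^ σ * Real.log n) := by rw [e3]; ring
      _ ≤ k * R * n + 1 * (τ * (n : ℝ) ^ σ * Real.log n) := by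
          gcongr
          rw [div_le_one (by positivity)]; linarith
      _ = _ := by ring
  have h4 : n * Real.log A ≤ Real.log A * (n : ℝ) ^ σ := by
    rw [mul_comm]; gcongr
  have h5 : k * R * n ≤ k * R * (n : ℝ) ^ σ := by gcongr
  linarith

/-- Stability of the sequences under shifts of the index. -/
theorem exists_shift_le {τ σ : ℝ} (hσ : 1 < σ) (hτ : 0 < τ) (s : ℕ) {h : ℝ} (hh : 1 ≤ h) :
    ∃ h' : ℝ, 1 ≤ h' ∧ ∀ N : ℕ, 1 ≤ N →
      h ^ (((N + s : ℕ) : ℝ) ^ σ) * defSeq τ σ (N + s) ≤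
        h' ^ ((N : ℝ) ^ σ) * defSeq τ σ N := by
  -- Chosen so that `(1 + s/N)^σ ≤ 1 + c/N`. The cross term `(c/N) ln N` then stays bounded, so the
  -- shift only changes `h`.
  set c : ℝ := σ * s * Real.exp (σ * s) with hc
  have hc0 : 0 ≤ c := by positivity
  set B : ℝ := Real.log h * (1 + c) + τ * (c + s + c * s) with hB
  have hlogh : 0 ≤ Real.log h := Real.log_nonneg hh
  refine ⟨Real.exp B, Real.one_le_exp (by positivity), fun N hN => ?_⟩
  have hN' : (1 : ℝ) ≤ N := by exact_mod_cast hN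
  have hlogN : 0 ≤ Real.log N := Real.log_nonneg hN'
  have hsN : (s : ℝ) / N ≤ s := div_le_self (by positivity) hN'
  have h1 : ((N + s : ℕ) : ℝ) ^ σ ≤ (N : ℝ) ^ σ * (1 + c / N) := by
    have e : ((N + s : ℕ) : ℝ) = N * (1 + s / N) := by push_cast; field_simp
    rw [e, Real.mul_rpow (by positivity) (by positivity)]
    gcongr
    calc (1 + (s : ℝ) / N) ^ σ ≤ (Real.exp (s / N)) ^ σ := by
          gcongr
          linarith [Real.add_one_le_exp ((s : ℝ) / N)]
      _ = Real.exp (σ * (s / N)) := by rw [← Real.exp_mul]; ring_nf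
      _ ≤ 1 + σ * (s / N) * Real.exp (σ * (s / N)) := by
          have h2 := Real.add_one_le_exp (-(σ * (s / N)))
          have h3 := mul_le_mul_of_nonneg_left h2 (Real.exp_pos (σ * ((s : ℝ) / N))).le
          rw [← Real.exp_add, add_neg_cancel, Real.exp_zero] at h3
          linarith
      _ ≤ 1 + σ * (s / N) * Real.exp (σ * s) := by gcongr
      _ = 1 + c / N := by rw [hc]; ring
  have h2 : Real.log ((N + s : ℕ) : ℝ) ≤ Real.log N + s / N := by
    have e : ((N + s : ℕ) : ℝ) = N * (1 + s / N) := by push_cast; field_simp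
    rw [e, Real.log_mul (by positivity) (by positivity)]
    gcongr
    have := Real.log_le_sub_one_of_pos (show 0 < 1 + (s : ℝ) / N by positivity)
    linarith
  rw [defSeq_eq_exp hN, defSeq_eq_exp (by omega), Real.rpow_def_of_pos (by linarith), ← Real.exp_mul,
    ← Real.exp_add, ← Real.exp_add]
  apply Real.exp_le_exp.2
  have hlogN1 : Real.log N / N ≤ 1 := by
    rw [div_le_one (by positivity)]
    linarith [Real.log_le_sub_one_of_pos (show (0 : ℝ) < N by positivity)]
  have hNσ : 0 < (N : ℝ) ^ σ := by positivity
  have hlogNs : 0 ≤ Real.log ((N + s : ℕ) : ℝ) := Real.log_natCast_nonneg _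
  have hcN : c / N ≤ c := div_le_self hc0 hN'
  have h3 : ((N + s : ℕ) : ℝ) ^ σ * Real.log ((N + s : ℕ) : ℝ) ≤
      (N : ℝ) ^ σ * (Real.log N + (c + s + c * s)) := by
    calc _ ≤ (N : ℝ) ^ σ * (1 + c / N) * (Real.log N + s / N) := by gcongr
      _ = (N : ℝ) ^ σ * (Real.log N + (c * (Real.log N / N) + s / N + c / N * (s / N))) := by ring
      _ ≤ (N : ℝ) ^ σ * (Real.log N + (c * 1 + s + c * s)) := by gcongr
      _ = _ := by ring
  have h4 : Real.log h * ((N + s : ℕ) : ℝ) ^ σ ≤ Real.log h * ((N : ℝ) ^ σ * (1 + c)) := by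
    gcongr
    exact h1.trans (by gcongr)
  have h5 := mul_le_mul_of_nonneg_left h3 hτ.le
  rw [hB]
  linarith

/-- Superadditivity of `x^σ` with a quantified gain, linear in the smaller number: `m ≤ (m+k)/2`
improves `m^{σ-1} ≤ (m+k)^{σ-1}` by the factor `(1/2)^{σ-1}`. -/
theorem rpow_add_rpow_le_sub {σ : ℝ} (hσ : 1 < σ) {m k : ℝ} (hm : 0 ≤ m) (hmk : m ≤ k) :
    m ^ σ + k ^ σ ≤ (m + k) ^ σ - (1 - (1 / 2) ^ (σ - 1)) * m * (m + k) ^ (σ - 1) := by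
  have hs : 0 < σ - 1 := by linarith
  have e : ∀ x : ℝ, 0 ≤ x → x ^ σ = x * x ^ (σ - 1) := fun x hx => by
    rcases hx.eq_or_lt with rfl | hx
    · simp [Real.zero_rpow (show σ ≠ 0 by linarith)]
    · rw [Real.rpow_sub_one hx.ne']; field_simp
  have hk : 0 ≤ k := hm.trans hmk
  rw [e m hm, e k hk, e (m + k) (by linarith)]
  have h1 : m ^ (σ - 1) ≤ (1 / 2) ^ (σ - 1) * (m + k) ^ (σ - 1) := by
    rw [← Real.mul_rpow (by norm_num) (by linarith)]
    gcongr
    linarith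
  have h2 : k ^ (σ - 1) ≤ (m + k) ^ (σ - 1) := by gcongr; linarith
  nlinarith [mul_le_mul_of_nonneg_left h1 hm, mul_le_mul_of_nonneg_left h2 hk]

/-- The binomial coefficient is at most `exp(m ln(m+k))` for the smaller index `m`, and the gain in
`rpow_add_rpow_le_sub` pays for it up to `e^{R m}`. The loss is geometric in `j` alone, so in the
Leibniz recursion it can be charged to the factor `h^{j^σ}`. -/
theorem exists_choose_mul_defSeq_le {τ σ : ℝ} (hσ : 1 < σ) (hτ : 0 < τ) :
    ∃ B : ℝ, 1 ≤ B ∧ ∀ j k : ℕ,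
      ((j + k).choose j : ℝ) * defSeq τ σ j * defSeq τ σ k ≤ B ^ j * defSeq τ σ (j + k) := by
  have ha : 0 < 1 - (1 / 2 : ℝ) ^ (σ - 1) := by
    have := Real.rpow_lt_one (show (0 : ℝ) ≤ 1 / 2 by norm_num) (by norm_num)
      (show 0 < σ - 1 by linarith)
    linarith
  set a := 1 - (1 / 2 : ℝ) ^ (σ - 1) with ha'
  obtain ⟨R, hR, hRn⟩ := exists_log_le_add hσ (show 0 < τ * a by positivity)
  have hB : 1 ≤ Real.exp R := Real.one_le_exp hR
  have main : ∀ m k : ℕ, 1 ≤ m → m ≤ k →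
      ((m + k).choose m : ℝ) * defSeq τ σ m * defSeq τ σ k ≤
        Real.exp R ^ m * defSeq τ σ (m + k) := by
    intro m k hm hmk
    have hn : 1 ≤ m + k := by omega
    have hn' : (1 : ℝ) ≤ (m + k : ℕ) := by exact_mod_cast hn
    have hm' : (1 : ℝ) ≤ m := by exact_mod_cast hm
    have hk' : (1 : ℝ) ≤ k := by exact_mod_cast hm.trans hmk
    have hlog : 0 ≤ Real.log ((m + k : ℕ) : ℝ) := Real.log_nonneg hn'
    have h1 : ((m + k).choose m : ℝ) ≤ Real.exp (m * Real.log ((m + k : ℕ) : ℝ)) := by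
      rw [Real.exp_nat_mul, Real.exp_log (by linarith)]
      exact_mod_cast Nat.choose_le_pow _ _
    have h2 : ∀ l : ℕ, 1 ≤ l → l ≤ m + k →
        defSeq τ σ l ≤ Real.exp (τ * (l : ℝ) ^ σ * Real.log ((m + k : ℕ) : ℝ)) := by
      intro l hl hlm
      rw [defSeq_eq_exp hl]
      have : (1 : ℝ) ≤ l := by exact_mod_cast hl
      gcongr
    calc _ ≤ Real.exp (m * Real.log ((m + k : ℕ) : ℝ)) *
          Real.exp (τ * (m : ℝ) ^ σ * Real.log ((m + k : ℕ) : ℝ)) *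
          Real.exp (τ * (k : ℝ) ^ σ * Real.log ((m + k : ℕ) : ℝ)) := by
          gcongr
          · exact (defSeq_pos hσ k).le
          · exact (defSeq_pos hσ m).le
          · exact h2 m hm (by omega)
          · exact h2 k (by omega) (by omega)
      _ ≤ _ := by
        rw [defSeq_eq_exp hn, ← Real.exp_nat_mul, ← Real.exp_add, ← Real.exp_add, ← Real.exp_add]
        apply Real.exp_le_exp.2
        have h3 := rpow_add_rpow_le_sub hσ (show (0 : ℝ) ≤ m by positivity)
          (show (m : ℝ) ≤ k by exact_mod_cast hmk)
        rw [← ha'] at h3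
        have h4 := mul_le_mul_of_nonneg_left h3 (mul_nonneg hτ.le hlog)
        have h5 := mul_le_mul_of_nonneg_left (hRn (m + k) hn) (show (0 : ℝ) ≤ m by positivity)
        push_cast at *
        linarith
  have hM := fun n => (defSeq_pos (τ := τ) hσ n).le
  refine ⟨Real.exp R, hB, fun j k => ?_⟩
  rcases Nat.eq_zero_or_pos j with rfl | hj
  · simp [defSeq_zero hσ]
  rcases Nat.eq_zero_or_pos k with rfl | hk
  · simpa [defSeq_zero hσ] using le_mul_of_one_le_left (hM j) (one_le_pow₀ hB)
  rcases le_total j k with h | h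
  · exact main j k hj h
  · have := main k j hk h
    rw [add_comm k j, Nat.choose_symm_add] at *
    calc _ = ((j + k).choose k : ℝ) * defSeq τ σ k * defSeq τ σ j := by
          rw [← Nat.choose_symm_add]; ring
      _ ≤ Real.exp R ^ k * defSeq τ σ (j + k) := by
          exact this
      _ ≤ _ := by
          have := hM (j + k)
          gcongr

/-- Bounds for the solution of the recursion coming from the Leibniz formula for `φ χ = g`. -/
theorem exists_le_of_leibniz {τ σ C h δ : ℝ} (hσ : 1 < σ) (hτ : 0 < τ) (hC : 0 < C) (hh : 1 ≤ h)
    (hδ : 0 < δ) :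
    ∃ A H : ℝ, 0 < A ∧ 1 ≤ H ∧ ∀ a : ℕ → ℝ,
      (∀ n, δ * a n ≤ C * (h ^ ((n : ℝ) ^ σ) * defSeq τ σ n) +
        ∑ j ∈ Finset.range n, (n.choose (j + 1) : ℝ) *
          (C * (h ^ (((j + 1 : ℕ) : ℝ) ^ σ) * defSeq τ σ (j + 1))) * a (n - (j + 1))) →
      ∀ n, a n ≤ A * (H ^ ((n : ℝ) ^ σ) * defSeq τ σ n) := by
  obtain ⟨B, hB, hBjk⟩ := exists_choose_mul_defSeq_le hσ hτ
  -- `H = B h M` leaves a factor `M^{-(j+1)} ≤ (1/M) 2^{-j}` in each term of the sum. With `M ≥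
  -- 4C/δ` the whole sum takes at most half of `δ A Q`, and `A = 2C/δ` gives the other half to the
  -- inhomogeneous term.
  set M := max 2 (4 * C / δ) with hM
  have hM2 : 2 ≤ M := le_max_left _ _
  have hMC : 4 * C / δ ≤ M := le_max_right _ _
  set H := B * h * M with hH
  have hHh : h ≤ H := by
    have : 1 ≤ B * M := one_le_mul_of_one_le_of_one_le hB (by linarith)
    calc h = 1 * h := by ring
      _ ≤ (B * M) * h := by gcongr
      _ = H := by rw [hH]; ring
  have hH1 : 1 ≤ H := hh.trans hHh
  refine ⟨2 * C / δ, H, by positivity, hH1, fun a ha n => ?_⟩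
  induction n using Nat.strong_induction_on with
  | _ n ih =>
    set A := 2 * C / δ with hA
    have hApos : 0 < A := by positivity
    set Q := H ^ ((n : ℝ) ^ σ) * defSeq τ σ n with hQ
    have hDn := defSeq_pos (τ := τ) hσ n
    have hQpos : 0 < Q := by positivity
    have term : ∀ j ∈ Finset.range n, (n.choose (j + 1) : ℝ) *
          (C * (h ^ (((j + 1 : ℕ) : ℝ) ^ σ) * defSeq τ σ (j + 1))) * a (n - (j + 1)) ≤
          C * A * Q * ((1 / M) * (1 / 2) ^ j) := by
      intro j hj
      rw [Finset.mem_range] at hj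
      obtain ⟨k, rfl⟩ : ∃ k, n = (j + 1) + k := ⟨n - (j + 1), by omega⟩
      rw [Nat.add_sub_cancel_left]
      have h1 := ih k (by omega)
      have h2 := hBjk (j + 1) k
      have hD := defSeq_pos (τ := τ) hσ (j + 1)
      have hDk := defSeq_pos (τ := τ) hσ k
      generalize hi : j + 1 = i at *
      have hsup : (i : ℝ) ^ σ + (k : ℝ) ^ σ ≤ ((i + k : ℕ) : ℝ) ^ σ := by
        push_cast
        exact Real.add_rpow_le_rpow_add (by positivity) (by positivity) hσ.le
      have h3 : H ^ ((i : ℝ) ^ σ) * H ^ ((k : ℝ) ^ σ) ≤ H ^ (((i + k : ℕ) : ℝ) ^ σ) := by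
        rw [← Real.rpow_add (by linarith)]
        gcongr
      have h4 : B ^ i * h ^ ((i : ℝ) ^ σ) * M ^ i ≤ H ^ ((i : ℝ) ^ σ) := by
        rw [hH, Real.mul_rpow (by positivity) (by positivity),
          Real.mul_rpow (by positivity) (by positivity), ← Real.rpow_natCast B i,
          ← Real.rpow_natCast M i]
        have := le_natCast_rpow hσ i
        have hM1 : 1 ≤ M := by linarith
        gcongr
      have h5 : B ^ i * h ^ ((i : ℝ) ^ σ) * H ^ ((k : ℝ) ^ σ) ≤
          H ^ (((i + k : ℕ) : ℝ) ^ σ) * (1 / M) ^ i := by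
        rw [one_div, inv_pow, ← div_eq_mul_inv, le_div_iff₀ (by positivity)]
        calc _ = B ^ i * h ^ ((i : ℝ) ^ σ) * M ^ i * H ^ ((k : ℝ) ^ σ) := by ring
          _ ≤ H ^ ((i : ℝ) ^ σ) * H ^ ((k : ℝ) ^ σ) := by gcongr
          _ ≤ _ := h3
      have h6 : (1 / M) ^ i ≤ 1 / M * (1 / 2) ^ j := by
        rw [← hi, pow_succ']
        gcongr
      calc _ ≤ ((i + k).choose i : ℝ) * (C * (h ^ ((i : ℝ) ^ σ) * defSeq τ σ i)) *
            (A * (H ^ ((k : ℝ) ^ σ) * defSeq τ σ k)) := by gcongr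
        _ = C * A * (h ^ ((i : ℝ) ^ σ) * H ^ ((k : ℝ) ^ σ)) *
            (((i + k).choose i : ℝ) * defSeq τ σ i * defSeq τ σ k) := by ring
        _ ≤ C * A * (h ^ ((i : ℝ) ^ σ) * H ^ ((k : ℝ) ^ σ)) *
            (B ^ i * defSeq τ σ (i + k)) := by gcongr
        _ = C * A * defSeq τ σ (i + k) * (B ^ i * h ^ ((i : ℝ) ^ σ) * H ^ ((k : ℝ) ^ σ)) := by ring
        _ ≤ C * A * defSeq τ σ (i + k) *
            (H ^ (((i + k : ℕ) : ℝ) ^ σ) * (1 / M * (1 / 2) ^ j)) := by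
            refine mul_le_mul_of_nonneg_left (h5.trans ?_) (by positivity)
            gcongr
        _ = _ := by rw [hQ]; ring
    have hsum := Finset.sum_le_sum term
    rw [← Finset.mul_sum, ← Finset.mul_sum] at hsum
    have hgeo : ∑ j ∈ Finset.range n, (1 / 2 : ℝ) ^ j ≤ 2 := sum_geometric_two_le n
    have h7 : C * A * Q * (1 / M * ∑ j ∈ Finset.range n, (1 / 2 : ℝ) ^ j) ≤ δ * A * Q / 2 := by
      have : C * (1 / M * ∑ j ∈ Finset.range n, (1 / 2 : ℝ) ^ j) ≤ δ / 2 := by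
        calc _ ≤ C * (1 / M * 2) := by gcongr
          _ = 2 * C / M := by ring
          _ ≤ δ / 2 := by
            rw [div_le_iff₀ hδ] at hMC
            rw [div_le_div_iff₀ (by linarith) (by norm_num)]
            linarith
      calc _ = A * Q * (C * (1 / M * ∑ j ∈ Finset.range n, (1 / 2 : ℝ) ^ j)) := by ring
        _ ≤ A * Q * (δ / 2) := by gcongr
        _ = _ := by ring
    have h8 : C * (h ^ ((n : ℝ) ^ σ) * defSeq τ σ n) ≤ δ * A * Q / 2 := by
      have e : δ * A / 2 = C := by rw [hA]; field_simp
      calc _ ≤ C * Q := by rw [hQ]; gcongr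
        _ = δ * A / 2 * Q := by rw [e]
        _ = _ := by ring
    have h9 := ha n
    have : δ * a n ≤ δ * (A * Q) := by linarith
    exact le_of_mul_le_mul_left this hδ

/-! ### Gevrey bump functions -/

/-- The powers `x⁻¹ ^ i` make the induction close: differentiation produces exponents `i + 2` and `i
+ 1`, the latter with a factor `i` that the factorial absorbs. The base case is `s^i e^{-s} ≤ i!`.
-/
theorem abs_iteratedDeriv_inv_pow_mul_expNegInvGlue_le (n : ℕ) : ∀ (i : ℕ) (x : ℝ),
    |iteratedDeriv n (fun x => x⁻¹ ^ i * expNegInvGlue x) x| ≤ 2 ^ n * ((i + 2 * n).factorial : ℝ) := by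
  have hsmooth : ∀ (i n : ℕ), ContDiff ℝ n (fun x : ℝ => x⁻¹ ^ i * expNegInvGlue x) := by
    intro i n
    have := expNegInvGlue.contDiff_polynomial_eval_inv_mul (n := n) (Polynomial.X ^ i)
    simpa using this
  induction n with
  | zero =>
    intro i x
    simp only [iteratedDeriv_zero, pow_zero, one_mul, mul_zero, add_zero]
    rcases le_or_gt x 0 with hx | hx
    · simp [expNegInvGlue.zero_of_nonpos hx]
    · have hx' : 0 < x⁻¹ := inv_pos.2 hx
      have h1 := Real.pow_div_factorial_le_exp _ hx'.le i
      rw [abs_of_nonneg (mul_nonneg (by positivity) (expNegInvGlue.nonneg x))]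
      simp only [expNegInvGlue, not_le.2 hx, if_false]
      rw [Real.exp_neg, ← div_eq_mul_inv, div_le_iff₀ (Real.exp_pos _)]
      rwa [div_le_iff₀ (by positivity), mul_comm] at h1
  | succ n ih =>
    intro i x
    have hd : deriv (fun x : ℝ => x⁻¹ ^ i * expNegInvGlue x) =
        (fun x : ℝ => x⁻¹ ^ (i + 2) * expNegInvGlue x) -
          (fun x : ℝ => (i : ℝ) * (x⁻¹ ^ (i + 1) * expNegInvGlue x)) := by
      ext x
      have := (expNegInvGlue.hasDerivAt_polynomial_eval_inv_mul (Polynomial.X ^ i) x).deriv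
      simp only [Polynomial.eval_pow, Polynomial.eval_X] at this
      rw [this]
      rcases Nat.eq_zero_or_pos i with rfl | hi
      · simp
      · obtain ⟨j, rfl⟩ : ∃ j, i = j + 1 := ⟨i - 1, by omega⟩
        simp
        ring
    rw [iteratedDeriv_succ', hd, iteratedDeriv_sub (hsmooth _ _).contDiffAt
      (contDiff_const.mul (hsmooth _ _)).contDiffAt,
      iteratedDeriv_const_mul _ (hsmooth _ _).contDiffAt]
    have h1 := ih (i + 2) x
    have h2 := ih (i + 1) x
    have h3 : (i : ℝ) * ((i + 1 + 2 * n).factorial : ℝ) ≤ ((i + 2 + 2 * n).factorial : ℝ) := by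
      have : i + 2 + 2 * n = (i + 1 + 2 * n) + 1 := by ring
      rw [this, Nat.factorial_succ]
      push_cast
      gcongr
      linarith
    have h4 : i + 2 * (n + 1) = i + 2 + 2 * n := by ring
    rw [h4]
    calc _ ≤ |iteratedDeriv n (fun x => x⁻¹ ^ (i + 2) * expNegInvGlue x) x| +
          |(i : ℝ) * iteratedDeriv n (fun x => x⁻¹ ^ (i + 1) * expNegInvGlue x) x| := abs_sub _ _
      _ ≤ 2 ^ n * ((i + 2 + 2 * n).factorial : ℝ) +
          i * (2 ^ n * ((i + 1 + 2 * n).factorial : ℝ)) := by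
          rw [abs_mul, Nat.abs_cast]
          gcongr
      _ ≤ 2 ^ n * ((i + 2 + 2 * n).factorial : ℝ) + 2 ^ n * ((i + 2 + 2 * n).factorial : ℝ) := by
          rw [mul_left_comm]
          gcongr
      _ = _ := by ring

theorem abs_iteratedDeriv_expNegInvGlue_le (n : ℕ) (x : ℝ) :
    |iteratedDeriv n expNegInvGlue x| ≤ 2 ^ n * ((2 * n).factorial : ℝ) := by
  simpa using abs_iteratedDeriv_inv_pow_mul_expNegInvGlue_le n 0 x

section NormSq

variable {E : Type*} [NormedAddCommGroup E] [InnerProductSpace ℝ E]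

theorem norm_iteratedFDeriv_id_le {T : ℝ} (hT : 1 ≤ T) {x : E} (hx : ‖x‖ ≤ T) (n : ℕ) :
    ‖iteratedFDeriv ℝ n (fun y : E => y) x‖ ≤ T := by
  rcases n with _ | n
  · simpa using hx
  · rw [← norm_iteratedFDeriv_fderiv]
    have : fderiv ℝ (fun y : E => y) = fun _ => ContinuousLinearMap.id ℝ E := by
      ext1 y; exact fderiv_fun_id
    rw [this]
    rcases n with _ | n
    · simpa using ContinuousLinearMap.norm_id_le.trans hT
    · rw [iteratedFDeriv_const_of_ne (by simp)]
      simp only [Pi.zero_apply, norm_zero]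
      linarith

/-- The crude geometric form is what the composition estimate `norm_iteratedFDeriv_comp_le` asks of
the inner function. -/
theorem norm_iteratedFDeriv_norm_sq_le {T : ℝ} (hT : 1 ≤ T) {x : E} (hx : ‖x‖ ≤ T) {n : ℕ}
    (hn : 1 ≤ n) : ‖iteratedFDeriv ℝ n (fun y : E => ‖y‖ ^ 2) x‖ ≤ (2 * T ^ 2) ^ n := by
  have h := (innerSL ℝ (E := E)).norm_iteratedFDeriv_le_of_bilinear_of_le_one
    (contDiff_id (𝕜 := ℝ) (n := (n : ℕ∞))) (contDiff_id (𝕜 := ℝ) (n := (n : ℕ∞))) x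
    (n := n) le_rfl (norm_innerSL_le _)
  have e : (fun y : E => ‖y‖ ^ 2) = fun y => innerSL ℝ (id y) (id y) := by
    ext y
    simp
  rw [e]
  refine h.trans ?_
  calc _ ≤ ∑ i ∈ Finset.range (n + 1), (n.choose i : ℝ) * T * T := by
        gcongr
        · exact norm_iteratedFDeriv_id_le hT hx _
        · exact norm_iteratedFDeriv_id_le hT hx _
    _ = 2 ^ n * (T ^ 2) ^ 1 := by
        rw [← Finset.sum_mul, ← Finset.sum_mul]
        have := Nat.sum_range_choose n
        rw [← Nat.cast_sum, this]
        push_cast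
        ring
    _ ≤ 2 ^ n * (T ^ 2) ^ n := by
        gcongr
        exact one_le_pow₀ hT
    _ = _ := by rw [mul_pow]

/-- The standard bump function of the ball of radius `r`. -/
def ballBump (r : ℝ) (x : E) : ℝ := expNegInvGlue (r ^ 2 - ‖x‖ ^ 2)

theorem contDiff_ballBump (r : ℝ) : ContDiff ℝ ∞ (ballBump r : E → ℝ) :=
  expNegInvGlue.contDiff.comp (contDiff_const.sub (contDiff_norm_sq ℝ))

/-- The composition estimate contributes `n!` and the outer function `(2n)!`. Order three is not
sharp, but every Gevrey bound lies below the extended Gevrey bounds by `exists_pow_mul_pow_le`. -/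
theorem norm_iteratedFDeriv_ballBump_le (r : ℝ) {T : ℝ} (hT : 1 ≤ T) {x : E} (hx : ‖x‖ ≤ T)
    (n : ℕ) : ‖iteratedFDeriv ℝ n (ballBump r) x‖ ≤ (n : ℝ) ^ (3 * n) * (16 * T ^ 2) ^ n := by
  have hG : ContDiff ℝ ∞ (fun s : ℝ => expNegInvGlue (r ^ 2 - s)) :=
    expNegInvGlue.contDiff.comp (contDiff_const.sub contDiff_id)
  have h := norm_iteratedFDeriv_comp_le (n := n) hG (contDiff_norm_sq ℝ (E := E))
    (by exact_mod_cast le_top) x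
    (C := 2 ^ n * ((2 * n).factorial : ℝ)) (D := 2 * T ^ 2) (fun i hi => by
      rw [norm_iteratedFDeriv_eq_norm_iteratedDeriv, iteratedDeriv_comp_const_sub, norm_smul,
        norm_pow, norm_neg, norm_one, one_pow, one_mul]
      refine (abs_iteratedDeriv_expNegInvGlue_le i _).trans ?_
      gcongr
      norm_num) (fun i hi _ => norm_iteratedFDeriv_norm_sq_le hT hx hi)
  refine h.trans ?_
  have h1 : (n.factorial : ℝ) ≤ (n : ℝ) ^ n := by exact_mod_cast Nat.factorial_le_pow n
  have h2 : ((2 * n).factorial : ℝ) ≤ ((2 * n : ℕ) : ℝ) ^ (2 * n) := by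
    exact_mod_cast Nat.factorial_le_pow (2 * n)
  calc _ ≤ (n : ℝ) ^ n * (2 ^ n * ((2 * n : ℕ) : ℝ) ^ (2 * n)) * (2 * T ^ 2) ^ n := by gcongr
    _ = (n : ℝ) ^ (3 * n) * (16 * T ^ 2) ^ n := by
      push_cast
      rw [mul_pow (2 : ℝ) (n : ℝ), pow_mul (2 : ℝ) 2 n, show (3 : ℕ) * n = n + 2 * n by ring, pow_add,
        show (16 : ℝ) * T ^ 2 = 2 * 2 ^ 2 * (2 * T ^ 2) by ring, mul_pow _ (2 * T ^ 2),
        mul_pow (2 : ℝ) (2 ^ 2)]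
      ring

end NormSq

theorem support_ballBump {E : Type*} [NormedAddCommGroup E] {r : ℝ} (hr : 0 < r) :
    Function.support (ballBump r : E → ℝ) = Metric.ball 0 r := by
  ext x
  simp only [Function.mem_support, ballBump, ne_eq, expNegInvGlue.zero_iff_nonpos, not_le,
    sub_pos, mem_ball_zero_iff]
  exact sq_lt_sq₀ (norm_nonneg _) hr.le

theorem norm_iteratedFDeriv_single_le {d n : ℕ} (φ : Rd d → ℂ) (x : Rd d) (i : Fin n → Fin d) :
    ‖iteratedFDeriv ℝ n φ x (fun k => EuclideanSpace.single (i k) (1 : ℝ))‖ ≤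
      ‖iteratedFDeriv ℝ n φ x‖ := by
  refine (ContinuousMultilinearMap.le_opNorm _ _).trans ?_
  simp

/-- Every ball is the support of a window of extended Gevrey class. -/
theorem exists_bump {τ σ r : ℝ} (hσ : 1 < σ) (hτ : 0 < τ) (hr : 0 < r) (d : ℕ) :
    ∃ g : TestFun d, IsExtGevrey τ σ g ∧ tsupport g = Metric.closedBall 0 r ∧ g 0 ≠ 0 ∧
      ∀ x, (starRingEnd ℂ) (g x) = g x := by
  have hsm : ContDiff ℝ ∞ (fun x : Rd d => ((ballBump r x : ℝ) : ℂ)) :=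
    Complex.ofRealCLM.contDiff.comp (contDiff_ballBump r)
  have hsupp : Function.support (fun x : Rd d => ((ballBump r x : ℝ) : ℂ)) = Metric.ball 0 r := by
    rw [← support_ballBump hr]
    ext x
    simp
  have htsupp : tsupport (fun x : Rd d => ((ballBump r x : ℝ) : ℂ)) = Metric.closedBall 0 r := by
    rw [tsupport, hsupp, closure_ball _ hr.ne']
  refine ⟨⟨fun x => ((ballBump r x : ℝ) : ℂ), hsm, ?_, fun _ _ => trivial⟩, ⟨hsm, ?_⟩, htsupp, ?_,
    fun x => Complex.conj_ofReal _⟩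
  · rw [HasCompactSupport, htsupp]
    exact isCompact_closedBall _ _
  · intro K hK
    obtain ⟨R, hR⟩ := hK.isBounded.exists_norm_le
    obtain ⟨h, hh, hhn⟩ := exists_pow_mul_pow_le hσ hτ 3
      (A := 16 * (max 1 R) ^ 2) (by
        have : 1 ≤ max 1 R := le_max_left _ _
        nlinarith)
    refine ⟨h, by linarith, 1, one_pos, fun x hx n i => ?_⟩
    refine (norm_iteratedFDeriv_single_le _ _ _).trans ?_
    rw [one_mul]
    refine le_trans ?_ (hhn n)
    refine le_trans (le_of_eq ?_) (norm_iteratedFDeriv_ballBump_le r (le_max_left 1 R)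
      ((hR x hx).trans (le_max_right _ _)) n)
    exact Complex.ofRealLI.norm_iteratedFDeriv_comp_left (f := ballBump r)
      (contDiff_ballBump r).contDiffAt (i := n) (by exact_mod_cast le_top)
  · have : (0 : Rd d) ∈ Function.support (fun x : Rd d => ((ballBump r x : ℝ) : ℂ)) := by
      rw [hsupp]; simpa using hr
    exact this

/-! ### Derivatives along coordinate directions, and division -/

section Division

/-- The pure partial derivative `∂_j^n f`. -/
def dirDeriv {d : ℕ} (j : Fin d) (n : ℕ) (f : Rd d → ℂ) (x : Rd d) : ℂ :=
  iteratedFDeriv ℝ n f x (fun _ => EuclideanSpace.single j (1 : ℝ))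

variable {d : ℕ}

/-- Restriction to a line makes the one-variable Leibniz formula available. Pure derivatives suffice
later because they control the Fourier coefficients. -/
theorem dirDeriv_eq_iteratedDeriv (j : Fin d) (n : ℕ) {f : Rd d → ℂ} (hf : ContDiff ℝ ∞ f)
    (x : Rd d) :
    dirDeriv j n f x =
      iteratedDeriv n (fun s : ℝ => f (x + s • EuclideanSpace.single j (1 : ℝ))) 0 := by
  set e : Rd d := EuclideanSpace.single j (1 : ℝ)
  have hg : ContDiff ℝ ∞ (fun y => f (x + y)) := hf.comp (contDiff_const.add contDiff_id)
  have h := (ContinuousLinearMap.toSpanSingleton ℝ e).iteratedFDeriv_comp_right hg 0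
    (i := n) (by exact_mod_cast le_top)
  rw [iteratedDeriv_eq_iteratedFDeriv]
  have h2 : (fun s : ℝ => f (x + s • e)) =
      (fun y => f (x + y)) ∘ (ContinuousLinearMap.toSpanSingleton ℝ e) := by
    ext s; simp
  rw [h2, h, iteratedFDeriv_comp_add_left, dirDeriv]
  simp [e]

theorem contDiff_line (j : Fin d) {f : Rd d → ℂ} (hf : ContDiff ℝ ∞ f) (x : Rd d) :
    ContDiff ℝ ∞ (fun s : ℝ => f (x + s • EuclideanSpace.single j (1 : ℝ))) :=
  hf.comp (contDiff_const.add (contDiff_id.smul contDiff_const))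

theorem dirDeriv_mul (j : Fin d) (n : ℕ) {f g : Rd d → ℂ} (hf : ContDiff ℝ ∞ f)
    (hg : ContDiff ℝ ∞ g) (x : Rd d) :
    dirDeriv j n (fun y => f y * g y) x =
      ∑ i ∈ Finset.range (n + 1), n.choose i * dirDeriv j i f x * dirDeriv j (n - i) g x := by
  rw [dirDeriv_eq_iteratedDeriv j n (hf.mul hg)]
  simp_rw [dirDeriv_eq_iteratedDeriv j _ hf, dirDeriv_eq_iteratedDeriv j _ hg]
  exact iteratedDeriv_fun_mul
    ((contDiff_line j hf x).of_le (by exact_mod_cast le_top)).contDiffAt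
    ((contDiff_line j hg x).of_le (by exact_mod_cast le_top)).contDiffAt

theorem dirDeriv_zero (j : Fin d) (f : Rd d → ℂ) (x : Rd d) : dirDeriv j 0 f x = f x := by
  simp [dirDeriv]

theorem dirDeriv_comp_sub (j : Fin d) (n : ℕ) (f : Rd d → ℂ) (a x : Rd d) :
    dirDeriv j n (fun y => f (y - a)) x = dirDeriv j n f (x - a) := by
  simp [dirDeriv, iteratedFDeriv_comp_sub]

theorem dirDeriv_eq_zero_of_notMem_tsupport (j : Fin d) (n : ℕ) {f : Rd d → ℂ} {x : Rd d}
    (hx : x ∉ tsupport f) : dirDeriv j n f x = 0 := by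
  have : iteratedFDeriv ℝ n f x = 0 := by
    by_contra h
    exact hx (support_iteratedFDeriv_subset n h)
  simp [dirDeriv, this]

theorem contDiff_div_of_ne_zero {f g : Rd d → ℂ} (hf : ContDiff ℝ ∞ f) (hg : ContDiff ℝ ∞ g)
    (h : ∀ x ∈ tsupport g, f x ≠ 0) : ContDiff ℝ ∞ (fun x => g x / f x) := by
  rw [contDiff_iff_contDiffAt]
  intro x
  by_cases hx : x ∈ tsupport g
  · simp_rw [div_eq_mul_inv]
    exact hg.contDiffAt.mul (hf.contDiffAt.inv (h x hx))
  · have h0 : (fun x => g x / f x) =ᶠ[𝓝 x] fun _ => 0 := by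
      filter_upwards [(isClosed_tsupport g).isOpen_compl.mem_nhds hx] with y hy
      rw [image_eq_zero_of_notMem_tsupport hy, zero_div]
    exact contDiffAt_const.congr_of_eventuallyEq h0

theorem tsupport_div_subset (f g : Rd d → ℂ) : tsupport (fun x => g x / f x) ⊆ tsupport g := by
  apply closure_mono
  intro x hx h
  apply hx
  simp [h]

/-- Division by a nonvanishing function of extended Gevrey class, with bounds for the pure partial
derivatives that are uniform with respect to translations of the numerator. -/
theorem exists_dirDeriv_div_le {τ σ r : ℝ} (hσ : 1 < σ) (hτ : 0 < τ) {φ g : Rd d → ℂ}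
    (hφ : IsExtGevrey τ σ φ) (hg : IsExtGevrey τ σ g) (hgr : tsupport g ⊆ Metric.closedBall 0 r)
    {x₀ : Rd d} (hne : ∀ x ∈ Metric.closedBall x₀ (2 * r), φ x ≠ 0) :
    ∃ A H : ℝ, 0 < A ∧ 1 ≤ H ∧ ∀ x ∈ Metric.closedBall x₀ r,
      tsupport (fun t => g (t - x) / φ t) ⊆ Metric.closedBall x₀ (2 * r) ∧
      ContDiff ℝ ∞ (fun t => g (t - x) / φ t) ∧
      (∀ t, φ t * (g (t - x) / φ t) = g (t - x)) ∧
      ∀ (j : Fin d) (n : ℕ) (t : Rd d), ‖dirDeriv j n (fun t => g (t - x) / φ t) t‖ ≤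
        A * (H ^ ((n : ℝ) ^ σ) * defSeq τ σ n) := by
  obtain ⟨h₁, hh₁, C₁, hC₁, hb₁⟩ := hφ.2 _ (isCompact_closedBall x₀ (2 * r))
  obtain ⟨h₂, hh₂, C₂, hC₂, hb₂⟩ := hg.2 _ (isCompact_closedBall 0 r)
  obtain ⟨δ, hδ, hδφ⟩ : ∃ δ : ℝ, 0 < δ ∧ ∀ x ∈ Metric.closedBall x₀ (2 * r), δ ≤ ‖φ x‖ := by
    rcases (Metric.closedBall x₀ (2 * r)).eq_empty_or_nonempty with he | hn
    · exact ⟨1, one_pos, by simp [he]⟩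
    · obtain ⟨y, hy, hmin⟩ := (isCompact_closedBall x₀ (2 * r)).exists_isMinOn hn
        hφ.1.continuous.norm.continuousOn
      exact ⟨‖φ y‖, norm_pos_iff.2 (hne y hy), fun x hx => hmin hx⟩
  set h := max 1 (max h₁ h₂)
  set C := max C₁ C₂
  have hC : 0 < C := lt_max_of_lt_left hC₁
  have hD := fun n => (defSeq_pos (τ := τ) hσ n).le
  have hbφ : ∀ t ∈ Metric.closedBall x₀ (2 * r), ∀ (j : Fin d) (n : ℕ),
      ‖dirDeriv j n φ t‖ ≤ C * (h ^ ((n : ℝ) ^ σ) * defSeq τ σ n) := by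
    intro t ht j n
    refine (hb₁ t ht n fun _ => j).trans ?_
    rw [mul_assoc]
    have := hD n
    gcongr
    · exact le_max_left _ _
    · exact (le_max_left _ _).trans (le_max_right _ _)
  have hbg : ∀ t ∈ Metric.closedBall 0 r, ∀ (j : Fin d) (n : ℕ),
      ‖dirDeriv j n g t‖ ≤ C * (h ^ ((n : ℝ) ^ σ) * defSeq τ σ n) := by
    intro t ht j n
    refine (hb₂ t ht n fun _ => j).trans ?_
    rw [mul_assoc]
    have := hD n
    gcongr
    · exact le_max_right _ _
    · exact (le_max_right _ _).trans (le_max_right _ _)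
  obtain ⟨A, H, hA, hH, hrec⟩ := exists_le_of_leibniz hσ hτ hC (le_max_left 1 (max h₁ h₂)) hδ
  refine ⟨A, H, hA, hH, fun x hx => ?_⟩
  have hgsm : ContDiff ℝ ∞ (fun t => g (t - x)) := hg.1.comp (contDiff_id.sub contDiff_const)
  have hmem : ∀ t ∈ tsupport (fun t => g (t - x)), t - x ∈ Metric.closedBall 0 r := by
    intro t ht
    apply hgr
    exact tsupport_comp_subset_preimage g (f := fun t => t - x) (by fun_prop) ht
  have hts : tsupport (fun t => g (t - x)) ⊆ Metric.closedBall x₀ (2 * r) := by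
    intro t ht
    have h1 := hmem t ht
    rw [mem_closedBall_zero_iff] at h1
    rw [Metric.mem_closedBall, dist_eq_norm] at hx ⊢
    calc ‖t - x₀‖ = ‖(t - x) + (x - x₀)‖ := by congr 1; abel
      _ ≤ ‖t - x‖ + ‖x - x₀‖ := norm_add_le _ _
      _ ≤ 2 * r := by linarith
  have hsm := contDiff_div_of_ne_zero hφ.1 hgsm fun t ht => hne t (hts ht)
  have hmul : ∀ t, φ t * (g (t - x) / φ t) = g (t - x) := by
    intro t
    by_cases ht : t ∈ tsupport (fun t => g (t - x))
    · exact mul_div_cancel₀ _ (hne t (hts ht))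
    · have : g (t - x) = 0 := image_eq_zero_of_notMem_tsupport (f := fun t => g (t - x)) ht
      simp [this]
  refine ⟨(tsupport_div_subset _ _).trans hts, hsm, hmul, fun j n t => ?_⟩
  by_cases ht : t ∈ tsupport (fun t => g (t - x))
  · refine hrec (fun n => ‖dirDeriv j n (fun t => g (t - x) / φ t) t‖) (fun n => ?_) n
    have hL := dirDeriv_mul j n hφ.1 hsm t
    simp_rw [hmul] at hL
    -- The term in which `φ` is not differentiated is split off; solving for it gives the recursion,
    -- with `|φ|` bounded below by `δ`.
    rw [dirDeriv_comp_sub, Finset.sum_range_succ'] at hL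
    simp only [Nat.choose_zero_right, Nat.cast_one, one_mul, dirDeriv_zero, Nat.sub_zero] at hL
    have hL' := (eq_sub_of_add_eq' hL.symm)
    calc δ * ‖dirDeriv j n (fun t => g (t - x) / φ t) t‖ ≤
          ‖φ t‖ * ‖dirDeriv j n (fun t => g (t - x) / φ t) t‖ := by
          gcongr
          exact hδφ t (hts ht)
      _ = ‖φ t * dirDeriv j n (fun t => g (t - x) / φ t) t‖ := (norm_mul _ _).symm
      _ ≤ ‖dirDeriv j n g (t - x)‖ + ∑ i ∈ Finset.range n, ‖n.choose (i + 1) *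
          dirDeriv j (i + 1) φ t * dirDeriv j (n - (i + 1)) (fun t => g (t - x) / φ t) t‖ := by
          rw [hL']
          refine (norm_sub_le _ _).trans ?_
          gcongr
          exact norm_sum_le _ _
      _ ≤ _ := by
          refine add_le_add (hbg _ (hmem t ht) j n) (Finset.sum_le_sum fun i _ => ?_)
          rw [norm_mul, norm_mul, Complex.norm_natCast]
          gcongr
          exact hbφ t (hts ht) j (i + 1)
  · rw [dirDeriv_eq_zero_of_notMem_tsupport j n fun h' => ht (tsupport_div_subset _ _ h'), norm_zero]
    have := hD n
    positivity

end Division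

/-! ### Fourier series of functions supported in the unit cube -/

section FourierSeries

open MeasureTheory UnitAddTorus
open scoped FourierTransform

variable {d : ℕ}

/-- The point of `ℝ^d` with given integer coordinates. -/
def latticePoint (k : Fin d → ℤ) : Rd d := WithLp.toLp 2 (fun i => (k i : ℝ))

/-- The representative of a point of the torus in the cube `(-1/2, 1/2]^d`. -/
def torusRep (z : UnitAddTorus (Fin d)) : Rd d :=
  WithLp.toLp 2 (fun i => ((AddCircle.equivIoc (1 : ℝ) (-1 / 2) (z i) : ℝ)))

theorem torusRep_coe {t : Fin d → ℝ} (ht : ∀ i, t i ∈ Ioc (-1 / 2 : ℝ) (-1 / 2 + 1)) :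
    torusRep (fun i => (t i : UnitAddCircle)) = WithLp.toLp 2 t := by
  unfold torusRep
  congr 1
  ext i
  rw [AddCircle.equivIoc_coe_eq (ht i)]

theorem norm_apply_le_norm_torusRep (z : UnitAddTorus (Fin d)) (i : Fin d) :
    ‖z i‖ ≤ ‖torusRep z‖ := by
  have h1 : ((AddCircle.equivIoc (1 : ℝ) (-1 / 2) (z i) : ℝ) : UnitAddCircle) = z i :=
    AddCircle.coe_equivIoc
  calc ‖z i‖ = ‖((AddCircle.equivIoc (1 : ℝ) (-1 / 2) (z i) : ℝ) : UnitAddCircle)‖ := by rw [h1]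
    _ ≤ ‖(AddCircle.equivIoc (1 : ℝ) (-1 / 2) (z i) : ℝ)‖ := QuotientAddGroup.norm_mk_le_norm
    _ = ‖torusRep z i‖ := rfl
    _ ≤ ‖torusRep z‖ := PiLp.norm_apply_le _ _

/-- The representative jumps only where some `z i` is the class of `-1/2`. There `‖z i‖ = 1/2 > a`,
so all nearby representatives lie where `f` vanishes. -/
theorem continuous_comp_torusRep {f : Rd d → ℂ} (hf : Continuous f) {a : ℝ} (ha : a < 1 / 2)
    (hsupp : ∀ t, a < ‖t‖ → f t = 0) : Continuous (fun z : UnitAddTorus (Fin d) => f (torusRep z)) := by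
  rw [continuous_iff_continuousAt]
  intro z
  by_cases hz : ∀ i, z i ≠ ((-1 / 2 : ℝ) : UnitAddCircle)
  · refine hf.continuousAt.comp ?_
    refine (PiLp.continuous_toLp 2 _).continuousAt.comp (continuousAt_pi.2 fun i => ?_)
    exact continuous_subtype_val.continuousAt.comp (ContinuousAt.comp
      (f := fun z : UnitAddTorus (Fin d) => z i)
      (AddCircle.continuousAt_equivIoc (1 : ℝ) (-1 / 2) (hz i)) (continuous_apply i).continuousAt)
  · push Not at hz
    obtain ⟨i, hi⟩ := hz
    have hnorm : a < ‖z i‖ := by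
      rw [hi, (AddCircle.norm_coe_eq_abs_iff (1 : ℝ) one_ne_zero).2 (by norm_num [abs_div])]
      have : |(-1 / 2 : ℝ)| = 1 / 2 := by norm_num [abs_div]
      rwa [this]
    have hev : (fun z : UnitAddTorus (Fin d) => f (torusRep z)) =ᶠ[𝓝 z] fun _ => 0 := by
      have hc : Continuous fun z : UnitAddTorus (Fin d) => ‖z i‖ := (continuous_apply i).norm
      filter_upwards [hc.continuousAt.eventually (lt_mem_nhds hnorm)] with y hy
      exact hsupp _ (hy.trans_le (norm_apply_le_norm_torusRep y i))
    exact continuousAt_const.congr hev.symm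

theorem mFourier_coe (k : Fin d → ℤ) (t : Rd d) :
    mFourier k (fun i => (t i : UnitAddCircle)) =
      Complex.exp (2 * Real.pi * Complex.I * ((inner ℝ t (latticePoint k) : ℝ) : ℂ)) := by
  simp only [mFourier, ContinuousMap.coe_mk, fourier_coe_apply, ← Complex.exp_sum]
  congr 1
  simp only [latticePoint, PiLp.inner_apply, Complex.ofReal_sum, Finset.mul_sum]
  refine Finset.sum_congr rfl fun i _ => ?_
  simp
  ring

theorem mFourierCoeff_comp_torusRep {f : Rd d → ℂ} {a : ℝ} (ha : a < 1 / 2)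
    (hsupp : ∀ t, a < ‖t‖ → f t = 0) (k : Fin d → ℤ) :
    mFourierCoeff (fun z : UnitAddTorus (Fin d) => f (torusRep z)) k = 𝓕 f (latticePoint k) := by
  have hR : 𝓕 f (latticePoint k) = ∫ x : Fin d → ℝ, Complex.exp
      ((↑(-2 * Real.pi * inner ℝ (WithLp.toLp 2 x) (latticePoint k)) * Complex.I)) •
        f (WithLp.toLp 2 x) := by
    rw [Real.fourier_eq',
      ← (EuclideanSpace.volume_preserving_symm_measurableEquiv_toLp (Fin d)).symm.integral_comp']
    rfl
  rw [mFourierCoeff_eq_integral _ _ (fun _ => -1 / 2), hR]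
  have hmeas : MeasurableSet {x : Fin d → ℝ | ∀ i, x i ∈ Ioc (-1 / 2 : ℝ) (-1 / 2 + 1)} :=
    MeasurableSet.univ_pi' fun i => measurableSet_Ioc
  rw [← setIntegral_eq_integral_of_forall_compl_eq_zero (f := fun x : Fin d → ℝ => Complex.exp
      ((↑(-2 * Real.pi * inner ℝ (WithLp.toLp 2 x) (latticePoint k)) * Complex.I)) •
        f (WithLp.toLp 2 x)) (s := {x : Fin d → ℝ | ∀ i, x i ∈ Ioc (-1 / 2 : ℝ) (-1 / 2 + 1)})]
  · refine setIntegral_congr_fun hmeas fun x hx => ?_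
    simp only
    rw [torusRep_coe hx]
    have := mFourier_coe (-k) (WithLp.toLp 2 x)
    simp only at this
    rw [this]
    have e : latticePoint (-k) = -latticePoint k := by
      ext i; simp [latticePoint]
    rw [e, inner_neg_right]
    congr 2
    push_cast
    ring
  · intro x hx
    have : f (WithLp.toLp 2 x) = 0 := by
      apply hsupp
      by_contra h
      push Not at h
      apply hx
      intro i
      have h1 : ‖x i‖ ≤ a := (PiLp.norm_apply_le (WithLp.toLp 2 x) i).trans h
      rw [Real.norm_eq_abs, abs_le] at h1
      constructor <;> linarith
    simp [this]

theorem integrable_of_hasCompactSupport_iteratedFDeriv {f : Rd d → ℂ} (hf : ContDiff ℝ ∞ f)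
    (hs : HasCompactSupport f) (n : ℕ) : Integrable (iteratedFDeriv ℝ n f) :=
  (hf.continuous_iteratedFDeriv (by exact_mod_cast le_top)).integrable_of_hasCompactSupport
    (hs.iteratedFDeriv n)

theorem norm_fourier_mul_pow_le {f : Rd d → ℂ} (hf : ContDiff ℝ ∞ f)
    (hsupp : tsupport f ⊆ Metric.closedBall 0 1) (j : Fin d) (n : ℕ) {B : ℝ}
    (hB : ∀ t, ‖dirDeriv j n f t‖ ≤ B) (w : Rd d) :
    |w j| ^ n * ‖𝓕 f w‖ ≤ volume.real (Metric.closedBall (0 : Rd d) 1) * B := by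
  have hcs : HasCompactSupport f :=
    HasCompactSupport.of_support_subset_isCompact (isCompact_closedBall 0 1)
      ((subset_tsupport f).trans hsupp)
  have hint := integrable_of_hasCompactSupport_iteratedFDeriv hf hcs
  have h := congrFun (Real.fourier_iteratedFDeriv (N := ⊤) hf (fun n _ => hint n) (n := n) le_top) w
  have h2 := congrArg (fun T => T (fun _ : Fin n => EuclideanSpace.single j (1 : ℝ))) h
  simp only [VectorFourier.fourierPowSMulRight_apply] at h2
  rw [Real.fourier_continuousMultilinearMap_apply (hint n)] at h2
  have h3 : ‖𝓕 (fun t => dirDeriv j n f t) w‖ = (2 * Real.pi * |w j|) ^ n * ‖𝓕 f w‖ := by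
    unfold dirDeriv
    have h5 : innerSL ℝ w (EuclideanSpace.single j (1 : ℝ)) = w j := by
      rw [innerSL_apply_apply, EuclideanSpace.inner_single_right]
      simp
    rw [h2]
    simp [mul_pow, abs_of_pos Real.pi_pos, h5]
    ring
  have h4 : ‖𝓕 (fun t => dirDeriv j n f t) w‖ ≤
      volume.real (Metric.closedBall (0 : Rd d) 1) * B := by
    rw [Real.fourier_eq]
    rw [← setIntegral_eq_integral_of_forall_compl_eq_zero (s := Metric.closedBall (0 : Rd d) 1)]
    · rw [mul_comm]
      refine norm_setIntegral_le_of_norm_le_const measure_closedBall_lt_top fun t _ => ?_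
      rw [Circle.norm_smul]
      exact hB t
    · intro t ht
      rw [dirDeriv_eq_zero_of_notMem_tsupport j n fun h => ht (hsupp h), smul_zero]
  rw [h3] at h4
  refine le_trans ?_ h4
  gcongr
  have : (3 : ℝ) < Real.pi := Real.pi_gt_three
  nlinarith [abs_nonneg (w j)]

/-- The Fourier series of a function supported in the interior of the unit cube. -/
theorem hasSum_fourier_latticePoint {f : Rd d → ℂ} (hf : Continuous f) {a : ℝ} (ha : a < 1 / 2)
    (hsupp : ∀ t, a < ‖t‖ → f t = 0)
    (hsum : Summable fun k : Fin d → ℤ => 𝓕 f (latticePoint k)) {t : Rd d} (ht : ‖t‖ < 1 / 2) :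
    HasSum (fun k : Fin d → ℤ => 𝓕 f (latticePoint k) *
      Complex.exp (2 * Real.pi * Complex.I * ((inner ℝ t (latticePoint k) : ℝ) : ℂ))) (f t) := by
  set F : C(UnitAddTorus (Fin d), ℂ) :=
    ⟨fun z => f (torusRep z), continuous_comp_torusRep hf ha hsupp⟩ with hF
  have hc : ∀ k, mFourierCoeff F k = 𝓕 f (latticePoint k) := mFourierCoeff_comp_torusRep ha hsupp
  have h := hasSum_mFourier_series_apply_of_summable (f := F) (by rwa [funext hc])
    (fun i => (t i : UnitAddCircle))
  simp only [hc, smul_eq_mul, mFourier_coe] at h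
  have e : F (fun i => (t i : UnitAddCircle)) = f t := by
    rw [hF, ContinuousMap.coe_mk]
    rw [torusRep_coe]
    intro i
    have h1 : ‖t i‖ < 1 / 2 := (PiLp.norm_apply_le t i).trans_lt ht
    rw [Real.norm_eq_abs, abs_lt] at h1
    constructor <;> linarith
  rwa [e] at h

end FourierSeries

/-! ### Distributions: finite order on compact sets, and series -/

section Distributions

variable {d : ℕ}

/-- Continuity on the test functions supported in `K` involves finitely many seminorms; `m` is the
largest order among them. -/
theorem exists_norm_distr_le (u : Distr d) {K : Set (Rd d)} (hK : IsCompact K) :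
    ∃ (m : ℕ) (C : ℝ), 0 < C ∧ ∀ (ψ : TestFun d) (B : ℝ), tsupport ψ ⊆ K → 0 ≤ B →
      (∀ i ≤ m, ∀ x, ‖iteratedFDeriv ℝ i ψ x‖ ≤ B) → ‖u ψ‖ ≤ C * B := by
  let K' : Compacts (Rd d) := ⟨K, hK⟩
  have hsub : (K' : Set (Rd d)) ⊆ (⊤ : Opens (Rd d)) := fun _ _ => trivial
  let T : 𝓓^{⊤}_{K'}(Rd d, ℂ) →L[ℂ] ℂ := u.comp (TestFunction.ofSupportedInCLM ℂ hsub)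
  obtain ⟨s, C, -, hC⟩ := Seminorm.bound_of_continuous
    (ContDiffMapSupportedIn.withSeminorms ℂ (Rd d) ℂ ⊤ K') ((normSeminorm ℂ ℂ).comp T.toLinearMap)
    (T.continuous.norm)
  refine ⟨s.sup id, C + 1, by positivity, fun ψ B hψ hB hbd => ?_⟩
  let f : 𝓓^{⊤}_{K'}(Rd d, ℂ) := ContDiffMapSupportedIn.of_support_subset ψ.contDiff
    ((subset_tsupport ψ).trans hψ)
  have hu : u ψ = T f := by
    rfl
  have h1 := hC f
  have h2 : s.sup (ContDiffMapSupportedIn.seminorm ℂ (Rd d) ℂ ⊤ K') f ≤ B := by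
    refine Seminorm.finset_sup_apply_le hB fun i hi => ?_
    rw [ContDiffMapSupportedIn.seminorm_top_le_iff ℂ hB]
    intro x _
    exact hbd i (Finset.le_sup (f := id) hi) x
  rw [hu]
  calc ‖T f‖ ≤ C * s.sup (ContDiffMapSupportedIn.seminorm ℂ (Rd d) ℂ ⊤ K') f := h1
    _ ≤ C * B := by gcongr
    _ ≤ _ := by gcongr; linarith

/-- Pointwise convergence identifies the remainder with the tail of the series, which is
differentiated termwise. The finite order of `u` on `K` then bounds `u` of the tail by the tail of
one summable majorant. -/
theorem hasSum_distr {ι : Type*} (u : Distr d) {K : Set (Rd d)} (hK : IsCompact K)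
    {ψ : ι → TestFun d} {Ψ : TestFun d} (hψ : ∀ k, tsupport (ψ k) ⊆ K) {v : ℕ → ι → ℝ}
    (hv : ∀ i, Summable (v i)) (hbd : ∀ i k x, ‖iteratedFDeriv ℝ i (ψ k) x‖ ≤ v i k)
    (hsum : ∀ x, HasSum (fun k => ψ k x) (Ψ x)) : HasSum (fun k => u (ψ k)) (u Ψ) := by
  obtain ⟨m, C, hC, hu⟩ := exists_norm_distr_le u hK
  have hΨ : tsupport Ψ ⊆ K := by
    refine closure_minimal (fun x hx => ?_) hK.isClosed
    by_contra hxK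
    apply hx
    have h0 : ∀ k, ψ k x = 0 := fun k =>
      image_eq_zero_of_notMem_tsupport fun h => hxK (hψ k h)
    have := hsum x
    simp only [h0] at this
    exact this.unique hasSum_zero
  set V : ι → ℝ := fun k => ∑ i ∈ Finset.range (m + 1), v i k with hV
  have hv0 : ∀ i k, 0 ≤ v i k := fun i k => (norm_nonneg _).trans (hbd i k 0)
  have hVs : Summable V := summable_sum fun i _ => hv i
  rw [HasSum, tendsto_iff_norm_sub_tendsto_zero]
  have hlim := (tendsto_tsum_compl_atTop_zero V).const_mul C
  rw [mul_zero] at hlim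
  refine squeeze_zero (fun _ => norm_nonneg _) (fun F => ?_) hlim
  rw [norm_sub_rev]
  have e1 : u Ψ - ∑ k ∈ F, u (ψ k) = u (Ψ - ∑ k ∈ F, ψ k) := by
    rw [map_sub, map_sum]
  rw [e1]
  have e2 : ∀ x, (Ψ - ∑ k ∈ F, ψ k) x = ∑' k : {k // k ∉ F}, ψ k x := by
    intro x
    have h1 : (Ψ - ∑ k ∈ F, ψ k) x = Ψ x - ∑ k ∈ F, ψ k x := by
      rw [FunLike.coe_sub, Pi.sub_apply, FunLike.coe_sum, Finset.sum_apply]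
    rw [h1, ← (hsum x).tsum_eq, ← (hsum x).summable.sum_add_tsum_subtype_compl F]
    ring
  apply hu
  · refine closure_minimal (fun x hx => ?_) hK.isClosed
    by_contra hxK
    apply hx
    rw [e2]
    have h0 : ∀ k, ψ k x = 0 := fun k =>
      image_eq_zero_of_notMem_tsupport fun h => hxK (hψ k h)
    simp [h0]
  · exact tsum_nonneg fun k => Finset.sum_nonneg fun i _ => hv0 i k
  · intro i hi x
    have e3 : ((Ψ - ∑ k ∈ F, ψ k : TestFun d) : Rd d → ℂ) =
        fun x => ∑' k : {k // k ∉ F}, ψ k x := funext e2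
    have hs : ∀ i, Summable fun k : {k // k ∉ F} => v i k := fun i => (hv i).subtype _
    rw [e3, iteratedFDeriv_tsum_apply (N := ⊤) (v := fun i (k : {k // k ∉ F}) => v i k)
      (fun k => (ψ k).contDiff) (fun i _ => hs i) (fun i k x _ => hbd i k x) le_top]
    have hns : Summable fun k : {k // k ∉ F} => ‖iteratedFDeriv ℝ i (ψ k) x‖ :=
      (hs i).of_nonneg_of_le (fun _ => norm_nonneg _) fun k => hbd i k x
    refine (norm_tsum_le_tsum_norm hns).trans ?_
    refine hns.tsum_le_tsum (fun k => ?_) (hVs.subtype _)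
    refine (hbd i k x).trans ?_
    exact Finset.single_le_sum (f := fun i => v i k) (fun i _ => hv0 i k)
      (Finset.mem_range.2 (by omega))

end Distributions

/-! ### Modulations -/

section Modulation

variable {d : ℕ}

theorem iteratedDeriv_exp_mul_ofReal (c : ℂ) (n : ℕ) :
    iteratedDeriv n (fun s : ℝ => Complex.exp (c * s)) =
      fun s : ℝ => c ^ n * Complex.exp (c * s) := by
  induction n with
  | zero => simp
  | succ n ih =>
    rw [iteratedDeriv_succ, ih]
    ext s
    have h : HasDerivAt (fun s : ℝ => c ^ n * Complex.exp (c * s))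
        (c ^ n * (Complex.exp (c * s) * (c * 1))) s :=
      (((Complex.ofRealCLM.hasDerivAt (x := s)).const_mul c).cexp).const_mul _
    rw [h.deriv]
    ring

/-- The factor `n!` comes from the general composition estimate and is harmless: for each use the
order is fixed and only the growth in `η` matters. The 7 bounds `2π`. -/
theorem norm_iteratedFDeriv_exp_inner_le (η : Rd d) (n : ℕ) (x : Rd d) :
    ‖iteratedFDeriv ℝ n (fun t : Rd d =>
      Complex.exp (2 * Real.pi * Complex.I * ((inner ℝ t η : ℝ) : ℂ))) x‖ ≤
      n.factorial * (7 * (1 + ‖η‖)) ^ n := by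
  set L : Rd d →L[ℝ] ℝ := (2 * Real.pi) • innerSL ℝ η with hL
  have hLn : ‖L‖ ≤ 7 * (1 + ‖η‖) := by
    rw [hL, norm_smul, innerSL_apply_norm, Real.norm_of_nonneg Real.two_pi_pos.le]
    have := Real.pi_lt_d2
    nlinarith [norm_nonneg η]
  have e : (fun t : Rd d => Complex.exp (2 * Real.pi * Complex.I * ((inner ℝ t η : ℝ) : ℂ))) =
      (fun s : ℝ => Complex.exp (Complex.I * s)) ∘ L := by
    ext t
    simp only [hL, Function.comp_apply, smul_apply, innerSL_apply_apply,
      smul_eq_mul, Complex.ofReal_mul, real_inner_comm η t]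
    congr 1
    push_cast
    ring
  rw [e]
  have hexp : ContDiff ℝ ∞ (fun s : ℝ => Complex.exp (Complex.I * s)) :=
    (contDiff_const.mul Complex.ofRealCLM.contDiff).cexp
  have h := norm_iteratedFDeriv_comp_le (n := n) hexp (L.contDiff (n := ∞))
    (by exact_mod_cast le_top) x (C := 1) (D := 7 * (1 + ‖η‖)) (fun i _ => by
      rw [norm_iteratedFDeriv_eq_norm_iteratedDeriv, iteratedDeriv_exp_mul_ofReal]
      simp [mul_comm Complex.I, Complex.norm_exp_ofReal_mul_I]) (fun i hi _ => by
      obtain ⟨i, rfl⟩ : ∃ k, i = k + 1 := ⟨i - 1, by omega⟩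
      rw [← norm_iteratedFDeriv_fderiv]
      have : fderiv ℝ L = fun _ => L := by
        ext1 y; exact L.fderiv
      rw [this]
      rcases i with _ | i
      · simpa using hLn
      · rw [iteratedFDeriv_const_of_ne (by simp)]
        simp only [Pi.zero_apply, norm_zero]
        positivity)
  simpa using h

theorem exists_norm_iteratedFDeriv_modulation_le (φ : TestFun d) (m : ℕ) :
    ∃ C : ℝ, 0 < C ∧ ∀ i ≤ m, ∀ η x : Rd d,
      ‖iteratedFDeriv ℝ i (modulation η φ) x‖ ≤ C * (1 + ‖η‖) ^ m := by
  have hb : ∀ l : ℕ, ∃ P : ℝ, ∀ x, ‖iteratedFDeriv ℝ l φ x‖ ≤ P := fun l =>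
    (φ.hasCompactSupport.iteratedFDeriv (𝕜 := ℝ) l).exists_bound_of_continuous
      (φ.contDiff.continuous_iteratedFDeriv (by exact_mod_cast le_top))
  choose P hP using hb
  have hP0 : ∀ l, 0 ≤ P l := fun l => (norm_nonneg _).trans (hP l 0)
  set S : ℕ → ℝ := fun i =>
    ∑ k ∈ Finset.range (i + 1), (i.choose k : ℝ) * (k.factorial * 7 ^ k) * P (i - k) with hS
  have hS0 : ∀ i, 0 ≤ S i := fun i => Finset.sum_nonneg fun k _ => by
    have := hP0 (i - k)
    positivity
  refine ⟨1 + ∑ i ∈ Finset.range (m + 1), S i,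
    by linarith [Finset.sum_nonneg fun i (_ : i ∈ Finset.range (m + 1)) => hS0 i],
    fun i hi η x => ?_⟩
  have h1 : 1 ≤ 1 + ‖η‖ := by linarith [norm_nonneg η]
  have hexp : ContDiff ℝ ∞ (fun t : Rd d =>
      Complex.exp (2 * Real.pi * Complex.I * ((inner ℝ t η : ℝ) : ℂ))) :=
    (contDiff_const.mul (Complex.ofRealCLM.contDiff.comp
      (contDiff_id.inner ℝ contDiff_const))).cexp
  have h := norm_iteratedFDeriv_mul_le (n := i) hexp φ.contDiff x (by exact_mod_cast le_top)
  calc _ ≤ _ := h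
    _ ≤ S i * (1 + ‖η‖) ^ m := by
      rw [hS, Finset.sum_mul]
      refine Finset.sum_le_sum fun k hk => ?_
      have hk' : k ≤ m := by
        rw [Finset.mem_range] at hk; omega
      calc _ ≤ (i.choose k : ℝ) * (k.factorial * (7 * (1 + ‖η‖)) ^ k) * P (i - k) := by
            gcongr
            · exact norm_iteratedFDeriv_exp_inner_le η k x
            · exact hP _ x
        _ = (i.choose k : ℝ) * (k.factorial * 7 ^ k) * P (i - k) * (1 + ‖η‖) ^ k := by
            rw [mul_pow]; ring
        _ ≤ _ := by
            have := hP0 (i - k)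
            gcongr
    _ ≤ _ := by
      gcongr
      have := Finset.single_le_sum (fun i _ => hS0 i) (Finset.mem_range.2 (Nat.lt_succ_of_le hi))
      linarith

theorem tsupport_modulation_subset (η : Rd d) (φ : TestFun d) :
    tsupport (modulation η φ) ⊆ tsupport φ :=
  closure_mono fun x hx h => hx (by
    change _ * φ x = 0
    rw [h, mul_zero])

/-- The exponent `m` is the order of `u` on `supp φ`: each derivative of the exponential costs one
factor `1 + ‖ξ‖`. -/
theorem exists_norm_fourierCutoff_le (u : Distr d) (φ : TestFun d) :
    ∃ (m : ℕ) (C : ℝ), 0 < C ∧ ∀ ξ : Rd d, ‖fourierCutoff u φ ξ‖ ≤ C * (1 + ‖ξ‖) ^ m := by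
  obtain ⟨m, C, hC, hu⟩ := exists_norm_distr_le u φ.hasCompactSupport
  obtain ⟨C', hC', hφ⟩ := exists_norm_iteratedFDeriv_modulation_le φ m
  refine ⟨m, C * C', by positivity, fun ξ => ?_⟩
  rw [mul_assoc]
  refine hu _ _ (tsupport_modulation_subset _ _) (by positivity) fun i hi x => ?_
  have := hφ i hi (-ξ) x
  rwa [norm_neg] at this

end Modulation

/-! ### Rapidly decreasing Fourier coefficients -/

section Coefficients

open MeasureTheory
open scoped FourierTransform

variable {d : ℕ}

/-- A summable weight on the lattice. -/
def latticeWeight (k : Fin d → ℤ) : ℝ := ((1 + ‖latticePoint k‖) ^ (d + 1))⁻¹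

theorem latticeWeight_pos (k : Fin d → ℤ) : 0 < latticeWeight k := by
  unfold latticeWeight
  positivity

theorem latticePoint_injective : Function.Injective (latticePoint : (Fin d → ℤ) → Rd d) := by
  intro k l h
  ext i
  have := congrArg (fun v : Rd d => v i) h
  simpa [latticePoint] using this

theorem summable_latticeWeight : Summable (latticeWeight : (Fin d → ℤ) → ℝ) := by
  set b := (EuclideanSpace.basisFun (Fin d) ℝ).toBasis
  set L := Submodule.span ℤ (Set.range b)
  have hmem : ∀ k : Fin d → ℤ, latticePoint k ∈ L := by
    intro k
    have : latticePoint k = ∑ i, k i • b i := by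
      ext j
      simp [latticePoint, b, EuclideanSpace.basisFun_apply, Finset.sum_apply, Pi.single_apply]
    rw [this]
    exact Submodule.sum_mem _ fun i _ =>
      Submodule.smul_mem _ _ (Submodule.subset_span (Set.mem_range_self i))
  have hrank : Module.finrank ℤ L < d + 1 := by
    have h1 : Module.finrank ℤ L = Module.finrank ℝ (Rd d) := ZLattice.rank ℝ L
    rw [h1]
    simp
  have h := ZLattice.summable_norm_pow_inv L (d + 1) hrank
  have hinj : Function.Injective fun k : Fin d → ℤ => (⟨latticePoint k, hmem k⟩ : L) :=
    fun k l hkl => latticePoint_injective (congrArg Subtype.val hkl)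
  have h2 := h.comp_injective hinj
  refine Summable.of_norm_bounded_eventually h2 ?_
  -- The comparison fails at `k = 0`, where the inverse norm is 0 by convention, so it is claimed
  -- only off that point.
  filter_upwards [(Set.finite_singleton (0 : Fin d → ℤ)).compl_mem_cofinite] with k hk
  have hk0 : 0 < ‖latticePoint k‖ := by
    rw [norm_pos_iff]
    intro h0
    apply hk
    apply latticePoint_injective
    rw [h0]
    ext i
    simp [latticePoint]
  rw [Real.norm_of_nonneg (latticeWeight_pos k).le]
  simp only [Function.comp_apply, latticeWeight, inv_pow, Submodule.coe_norm]
  gcongr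
  linarith

theorem one_add_pow_mul_le {x y a b : ℝ} (hx : 0 ≤ x) (hy : 0 ≤ y) (s : ℕ) (h0 : y ≤ a)
    (hs : x ^ s * y ≤ b) : (1 + x) ^ s * y ≤ 2 ^ s * (a + b) := by
  have h1 : (1 + x) ^ s ≤ 2 ^ s * (1 + x ^ s) := by
    rcases le_total x 1 with h | h
    · calc (1 + x) ^ s ≤ 2 ^ s := by gcongr; linarith
        _ ≤ _ := by
          have : 0 ≤ x ^ s := by positivity
          have h2 : (0 : ℝ) < 2 ^ s := by positivity
          nlinarith
    · calc (1 + x) ^ s ≤ (2 * x) ^ s := by gcongr; linarith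
        _ = 2 ^ s * x ^ s := mul_pow _ _ _
        _ ≤ _ := by gcongr; linarith
  calc (1 + x) ^ s * y ≤ 2 ^ s * (1 + x ^ s) * y := by gcongr
    _ = 2 ^ s * (y + x ^ s * y) := by ring
    _ ≤ _ := by gcongr

theorem norm_latticePoint_pow_mul_le (hd : 0 < d) (k : Fin d → ℤ) {n : ℕ} {y b : ℝ} (hy : 0 ≤ y)
    (h : ∀ j, |(k j : ℝ)| ^ n * y ≤ b) : ‖latticePoint k‖ ^ n * y ≤ (d : ℝ) ^ n * b := by
  have hne : (Finset.univ : Finset (Fin d)).Nonempty := ⟨⟨0, hd⟩, Finset.mem_univ _⟩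
  obtain ⟨j, -, hj⟩ := Finset.exists_max_image Finset.univ (fun j => |(k j : ℝ)|) hne
  have h1 : ‖latticePoint k‖ ≤ d * |(k j : ℝ)| := by
    calc ‖latticePoint k‖ = ‖∑ i, EuclideanSpace.single i ((k i : ℝ))‖ := by
          congr 1
          ext l
          simp [latticePoint, Finset.sum_apply, Pi.single_apply]
      _ ≤ ∑ i, ‖EuclideanSpace.single i ((k i : ℝ))‖ := norm_sum_le _ _
      _ = ∑ i : Fin d, |(k i : ℝ)| := by simp
      _ ≤ ∑ i : Fin d, |(k j : ℝ)| := Finset.sum_le_sum fun i _ => hj i (Finset.mem_univ _)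
      _ = d * |(k j : ℝ)| := by simp
  calc ‖latticePoint k‖ ^ n * y ≤ (d * |(k j : ℝ)|) ^ n * y := by gcongr
    _ = (d : ℝ) ^ n * (|(k j : ℝ)| ^ n * y) := by rw [mul_pow, mul_assoc]
    _ ≤ _ := by gcongr; exact h j

theorem dirDeriv_comp_smul (j : Fin d) (n : ℕ) {f : Rd d → ℂ} (hf : ContDiff ℝ ∞ f) (L : ℝ)
    (x : Rd d) : dirDeriv j n (fun y => f (L • y)) x = L ^ n * dirDeriv j n f (L • x) := by
  have h := (L • ContinuousLinearMap.id ℝ (Rd d)).iteratedFDeriv_comp_right hf x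
    (i := n) (by exact_mod_cast le_top)
  have e : f ∘ (L • ContinuousLinearMap.id ℝ (Rd d)) = fun y => f (L • y) := by
    ext y; simp
  rw [e] at h
  rw [dirDeriv, h, dirDeriv]
  simp only [ContinuousMultilinearMap.compContinuousLinearMap_apply, smul_apply,
    ContinuousLinearMap.id_apply]
  rw [ContinuousMultilinearMap.map_smul_univ]
  simp

/-- Fourier expansion, on a ball, of a function of extended Gevrey class supported in that ball. -/
theorem exists_fourier_expansion {τ σ ρ A H : ℝ} (hσ : 1 < σ) (hd : 0 < d) (hρ : 1 ≤ ρ)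
    (hA : 0 < A) (hH : 1 ≤ H) {χ : Rd d → ℂ} (hχ : ContDiff ℝ ∞ χ)
    (hsupp : tsupport χ ⊆ Metric.closedBall 0 ρ)
    (hb : ∀ (j : Fin d) (n : ℕ) (t : Rd d),
      ‖dirDeriv j n χ t‖ ≤ A * (H ^ ((n : ℝ) ^ σ) * defSeq τ σ n)) :
    ∃ c : (Fin d → ℤ) → ℂ,
      (∀ (n : ℕ) (k : Fin d → ℤ), ‖latticePoint k‖ ^ n * ‖c k‖ ≤
        volume.real (Metric.closedBall (0 : Rd d) 1) * A *
          ((d * (4 * ρ) * H) ^ ((n : ℝ) ^ σ) * defSeq τ σ n)) ∧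
      ∀ t ∈ Metric.closedBall (0 : Rd d) ρ, HasSum (fun k => c k *
        Complex.exp (2 * Real.pi * Complex.I *
          ((inner ℝ t ((4 * ρ)⁻¹ • latticePoint k) : ℝ) : ℂ))) (χ t) := by
  set V := volume.real (Metric.closedBall (0 : Rd d) 1)
  -- Rescaling by `4ρ` brings the support into the ball of radius `1/4`, well inside the unit cube.
  set L := 4 * ρ with hL
  have hLpos : 0 < L := by positivity
  have hL1 : 1 ≤ L := by linarith
  set f : Rd d → ℂ := fun y => χ (L • y) with hf
  have hfs : ContDiff ℝ ∞ f := hχ.comp (contDiff_const_smul L)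
  have hzero : ∀ t, 1 / 4 < ‖t‖ → f t = 0 := by
    intro t ht
    refine image_eq_zero_of_notMem_tsupport (f := χ) fun h => ?_
    have := hsupp h
    rw [mem_closedBall_zero_iff, norm_smul, Real.norm_of_nonneg hLpos.le] at this
    nlinarith
  have hfsupp : tsupport f ⊆ Metric.closedBall 0 1 := by
    refine closure_minimal (fun t ht => ?_) Metric.isClosed_closedBall
    rw [mem_closedBall_zero_iff]
    by_contra h
    exact ht (hzero t (by linarith))
  have hD := fun n => (defSeq_pos (τ := τ) hσ n).le
  have hfb : ∀ (j : Fin d) (n : ℕ) (t : Rd d),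
      ‖dirDeriv j n f t‖ ≤ L ^ n * (A * (H ^ ((n : ℝ) ^ σ) * defSeq τ σ n)) := by
    intro j n t
    rw [hf, dirDeriv_comp_smul j n hχ, norm_mul, norm_pow, Complex.norm_real,
      Real.norm_of_nonneg hLpos.le]
    gcongr
    exact hb j n _
  have hd1 : (1 : ℝ) ≤ d := by exact_mod_cast hd
  have hdec : ∀ (n : ℕ) (k : Fin d → ℤ), ‖latticePoint k‖ ^ n * ‖𝓕 f (latticePoint k)‖ ≤
        V * A * ((d * L * H) ^ ((n : ℝ) ^ σ) * defSeq τ σ n) := by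
    intro n k
    have h1 := norm_latticePoint_pow_mul_le hd k (norm_nonneg (𝓕 f (latticePoint k)))
      (fun j => norm_fourier_mul_pow_le hfs hfsupp j n (hfb j n) (latticePoint k))
    refine h1.trans ?_
    -- The geometric losses, `L^n` from scaling and `d^n` from passing from coordinates to the norm,
    -- are absorbed by `H` since `n ≤ n^σ`.
    have h2 : ((d : ℝ) * L) ^ n ≤ (d * L) ^ ((n : ℝ) ^ σ) := by
      rw [← Real.rpow_natCast]
      exact Real.rpow_le_rpow_of_exponent_le (one_le_mul_of_one_le_of_one_le hd1 hL1)
        (le_natCast_rpow hσ n)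
    have hV : 0 ≤ V := measureReal_nonneg
    have hDn := hD n
    calc _ = V * A * (((d : ℝ) * L) ^ n * H ^ ((n : ℝ) ^ σ) * defSeq τ σ n) := by
          rw [mul_pow]; ring
      _ ≤ V * A * ((d * L) ^ ((n : ℝ) ^ σ) * H ^ ((n : ℝ) ^ σ) * defSeq τ σ n) := by gcongr
      _ = _ := by rw [← Real.mul_rpow (by positivity) (by positivity)]
  refine ⟨fun k => 𝓕 f (latticePoint k), hdec, fun t ht => ?_⟩
  have hsum : Summable fun k : Fin d → ℤ => 𝓕 f (latticePoint k) := by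
    obtain ⟨E, hE⟩ : ∃ E, ∀ k : Fin d → ℤ,
        (1 + ‖latticePoint k‖) ^ (d + 1) * ‖𝓕 f (latticePoint k)‖ ≤ E :=
      ⟨_, fun k => one_add_pow_mul_le (norm_nonneg _) (norm_nonneg _) (d + 1)
        (by simpa using hdec 0 k) (hdec (d + 1) k)⟩
    refine Summable.of_norm_bounded (summable_latticeWeight.mul_left E) fun k => ?_
    rw [latticeWeight, ← div_eq_mul_inv, le_div_iff₀ (by positivity), mul_comm]
    exact hE k
  rw [mem_closedBall_zero_iff] at ht
  have h := hasSum_fourier_latticePoint hfs.continuous (show (1 / 4 : ℝ) < 1 / 2 by norm_num) hzero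
    hsum (t := L⁻¹ • t) (by
      rw [norm_smul, norm_inv, Real.norm_of_nonneg hLpos.le, inv_mul_lt_iff₀ hLpos]
      linarith)
  simp only [hf, smul_inv_smul₀ hLpos.ne'] at h
  simpa only [real_inner_smul_left, real_inner_smul_right] using h

end Coefficients

/-! ### Localization in cones -/

section Cones

variable {d : ℕ}

/-- `Γ₁` is the cone over a ball of radius `δ' ≤ δ/2` about `ξ₀`. After scaling `ξ` into that ball,
the perturbation has norm at most `δ'`, so the sum stays in the `δ`-ball inside `Γ`. The condition
`δ' ≤ ‖ξ₀‖` keeps the origin out and gives `ε ≤ 1/2`. -/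
theorem exists_conic_shrink {Γ : Set (Rd d)} {ξ₀ : Rd d} (h₀ : ξ₀ ≠ 0) (hΓ : IsConicNhd Γ ξ₀) :
    ∃ (Γ₁ : Set (Rd d)) (ε : ℝ), IsConicNhd Γ₁ ξ₀ ∧ 0 < ε ∧ ε ≤ 1 / 2 ∧
      ∀ ξ ∈ Γ₁, ∀ η : Rd d, ‖η‖ ≤ ε * ‖ξ‖ → ξ - η ∈ Γ := by
  obtain ⟨hnhd, hzero, hcone⟩ := hΓ
  obtain ⟨δ, hδ, hball⟩ := Metric.mem_nhds_iff.1 hnhd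
  have hξ₀ : 0 < ‖ξ₀‖ := norm_pos_iff.2 h₀
  set δ' := min (δ / 2) ‖ξ₀‖ with hδ'
  have hδ'pos : 0 < δ' := lt_min (by positivity) hξ₀
  refine ⟨{ξ | ∃ t : ℝ, 0 < t ∧ ‖t • ξ - ξ₀‖ < δ'}, δ' / (2 * ‖ξ₀‖), ⟨?_, ?_, ?_⟩,
    by positivity, ?_, ?_⟩
  · filter_upwards [Metric.ball_mem_nhds ξ₀ hδ'pos] with ξ hξ
    exact ⟨1, one_pos, by simpa [dist_eq_norm] using hξ⟩
  · rintro ⟨t, -, ht⟩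
    simp only [smul_zero, zero_sub, norm_neg] at ht
    exact absurd (min_le_right (δ / 2) ‖ξ₀‖) (not_le.2 ht)
  · rintro ξ ⟨t, ht, htξ⟩ s hs
    exact ⟨t * s⁻¹, by positivity, by rwa [smul_smul, inv_mul_cancel_right₀ hs.ne']⟩
  · rw [div_le_div_iff₀ (by positivity) (by norm_num)]
    have := min_le_right (δ / 2) ‖ξ₀‖
    rw [← hδ'] at this
    linarith
  · rintro ξ ⟨t, ht, htξ⟩ η hη
    have h1 : t * ‖ξ‖ ≤ 2 * ‖ξ₀‖ := by
      have h2 : ‖t • ξ‖ ≤ ‖t • ξ - ξ₀‖ + ‖ξ₀‖ := by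
        simpa using norm_add_le (t • ξ - ξ₀) ξ₀
      rw [norm_smul, Real.norm_of_nonneg ht.le] at h2
      have := min_le_right (δ / 2) ‖ξ₀‖
      linarith
    have h3 : ‖t • η‖ ≤ δ' := by
      rw [norm_smul, Real.norm_of_nonneg ht.le]
      calc t * ‖η‖ ≤ t * (δ' / (2 * ‖ξ₀‖) * ‖ξ‖) := by gcongr
        _ = δ' / (2 * ‖ξ₀‖) * (t * ‖ξ‖) := by ring
        _ ≤ δ' / (2 * ‖ξ₀‖) * (2 * ‖ξ₀‖) := by gcongr
        _ = δ' := by field_simp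
    have h4 : t • (ξ - η) ∈ Γ := by
      apply hball
      rw [Metric.mem_ball, dist_eq_norm]
      calc ‖t • (ξ - η) - ξ₀‖ = ‖(t • ξ - ξ₀) - t • η‖ := by rw [smul_sub]; congr 1; abel
        _ ≤ ‖t • ξ - ξ₀‖ + ‖t • η‖ := norm_sub_le _ _
        _ < δ' + δ' := by linarith
        _ ≤ δ := by have := min_le_left (δ / 2) ‖ξ₀‖; linarith
    have h5 := hcone _ h4 t⁻¹ (by positivity)
    rwa [inv_smul_smul₀ ht.ne'] at h5

end Cones

/-! ### The short-time Fourier transform and the wave-front set -/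

section WaveFront

variable {d : ℕ}

theorem conj_exp_inner (t ξ : Rd d) :
    (starRingEnd ℂ) (Complex.exp (2 * Real.pi * Complex.I * ((inner ℝ t ξ : ℝ) : ℂ))) =
      Complex.exp (2 * Real.pi * Complex.I * ((inner ℝ t (-ξ) : ℝ) : ℂ)) := by
  rw [← Complex.exp_conj, inner_neg_right]
  congr 1
  simp only [map_mul, Complex.conj_ofReal, Complex.conj_I, Complex.conj_ofNat, Complex.ofReal_neg]
  ring

/-- The window is `φ χ` up to conjugation, so the Fourier series of `χ` makes it a series of
modulations of `φ`. All terms are supported in `supp φ`, and the rapid decay of `c` outweighs the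
powers of `‖k‖` produced by differentiation. -/
theorem hasSum_stft (u : Distr d) (φ g : TestFun d) (x ξ : Rd d) {ρ : ℝ} (hρ : 1 ≤ ρ)
    (hφ : tsupport φ ⊆ Metric.closedBall 0 ρ) {χ : Rd d → ℂ}
    (hχ : ∀ t, φ t * χ t = (starRingEnd ℂ) (g (t - x))) {c : (Fin d → ℤ) → ℂ}
    (hc : ∀ s : ℕ, ∃ E : ℝ, ∀ k, (1 + ‖latticePoint k‖) ^ s * ‖c k‖ ≤ E)
    (hsum : ∀ t ∈ Metric.closedBall (0 : Rd d) ρ, HasSum (fun k => c k *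
        Complex.exp (2 * Real.pi * Complex.I *
          ((inner ℝ t ((4 * ρ)⁻¹ • latticePoint k) : ℝ) : ℂ))) (χ t)) :
    HasSum (fun k => c k * fourierCutoff u φ (ξ - (4 * ρ)⁻¹ • latticePoint k)) (stft g u x ξ) := by
  set κ : (Fin d → ℤ) → Rd d := fun k => (4 * ρ)⁻¹ • latticePoint k with hκ
  have hκn : ∀ k, ‖κ k‖ ≤ ‖latticePoint k‖ := by
    intro k
    rw [hκ, norm_smul, norm_inv, Real.norm_of_nonneg (by positivity)]
    exact mul_le_of_le_one_left (norm_nonneg _) (inv_le_one_of_one_le₀ (by linarith))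
  have hmod := fun i => exists_norm_iteratedFDeriv_modulation_le φ i
  choose M hM hMb using hmod
  have hdecay : ∀ i, ∃ E : ℝ, ∀ k, (1 + ‖latticePoint k‖) ^ i * ‖c k‖ ≤ E * latticeWeight k := by
    intro i
    obtain ⟨E, hE⟩ := hc (i + (d + 1))
    refine ⟨E, fun k => ?_⟩
    rw [latticeWeight, ← div_eq_mul_inv, le_div_iff₀ (by positivity)]
    calc _ = (1 + ‖latticePoint k‖) ^ (i + (d + 1)) * ‖c k‖ := by rw [pow_add]; ring
      _ ≤ E := hE k
  choose E hE using hdecay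
  have h := hasSum_distr u (K := tsupport φ) φ.hasCompactSupport
    (ψ := fun k => c k • modulation (-(ξ - κ k)) φ)
    (Ψ := conjugate (modulation ξ (translation x g)))
    (v := fun i k => M i * (1 + ‖ξ‖) ^ i * E i * latticeWeight k) ?_ ?_ ?_ ?_
  · simp only [map_smul, smul_eq_mul] at h
    exact h
  · intro k
    have hs : Function.support (c k • modulation (-(ξ - κ k)) φ) ⊆
        Function.support (modulation (-(ξ - κ k)) φ) := fun t ht h0 => ht (by
      rw [FunLike.coe_smul, Pi.smul_apply, h0, smul_zero])
    exact (closure_mono hs).trans (tsupport_modulation_subset _ φ)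
  · intro i
    exact summable_latticeWeight.mul_left _
  · intro i k t
    rw [FunLike.coe_smul, iteratedFDeriv_const_smul_apply
      ((modulation (-(ξ - κ k)) φ).contDiff.of_le (by exact_mod_cast le_top)).contDiffAt, norm_smul]
    have h1 : 1 + ‖-(ξ - κ k)‖ ≤ (1 + ‖ξ‖) * (1 + ‖latticePoint k‖) := by
      rw [norm_neg]
      have h2 := norm_sub_le ξ (κ k)
      have h3 := hκn k
      nlinarith [norm_nonneg ξ, norm_nonneg (latticePoint k)]
    calc _ ≤ ‖c k‖ * (M i * (1 + ‖-(ξ - κ k)‖) ^ i) := by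
          gcongr
          exact hMb i i le_rfl _ t
      _ ≤ ‖c k‖ * (M i * ((1 + ‖ξ‖) * (1 + ‖latticePoint k‖)) ^ i) := by
          have := (hM i).le
          gcongr
      _ = M i * (1 + ‖ξ‖) ^ i * ((1 + ‖latticePoint k‖) ^ i * ‖c k‖) := by rw [mul_pow]; ring
      _ ≤ M i * (1 + ‖ξ‖) ^ i * (E i * latticeWeight k) := by
          have := (hM i).le
          exact mul_le_mul_of_nonneg_left (hE i k) (by positivity)
      _ = _ := by ring
  · intro t
    have hΨ : conjugate (modulation ξ (translation x g)) t =
        Complex.exp (2 * Real.pi * Complex.I * ((inner ℝ t (-ξ) : ℝ) : ℂ)) * φ t * χ t := by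
      have h1 : conjugate (modulation ξ (translation x g)) t = (starRingEnd ℂ)
        (Complex.exp (2 * Real.pi * Complex.I * ((inner ℝ t ξ : ℝ) : ℂ)) * g (t - x)) := rfl
      rw [h1, map_mul, conj_exp_inner, ← hχ t]
      ring
    rw [hΨ]
    by_cases ht : t ∈ Metric.closedBall (0 : Rd d) ρ
    · have h2 := (hsum t ht).mul_left
        (Complex.exp (2 * Real.pi * Complex.I * ((inner ℝ t (-ξ) : ℝ) : ℂ)) * φ t)
      refine h2.congr_fun fun k => ?_
      have h3 : (c k • modulation (-(ξ - κ k)) φ) t = c k * (Complex.exp (2 * Real.pi * Complex.I *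
        ((inner ℝ t (-(ξ - κ k)) : ℝ) : ℂ)) * φ t) := rfl
      rw [h3]
      have h4 : -(ξ - κ k) = -ξ + κ k := by abel
      rw [h4, inner_add_right, Complex.ofReal_add, mul_add, Complex.exp_add]
      ring
    -- Outside the ball the periodic series need not represent `χ`, but the factor `φ` vanishes.
    · have h0 : φ t = 0 := image_eq_zero_of_notMem_tsupport fun h => ht (hφ h)
      rw [h0, mul_zero, zero_mul]
      convert hasSum_zero with k
      have h3 : (c k • modulation (-(ξ - κ k)) φ) t = c k * (Complex.exp (2 * Real.pi * Complex.I *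
        ((inner ℝ t (-(ξ - κ k)) : ℝ) : ℂ)) * φ t) := rfl
      rw [h3, h0, mul_zero, mul_zero]

/-- Decay, in a smaller cone, of the lattice convolution of a rapidly decreasing sequence with the
Fourier transform of a compactly supported distribution. -/
theorem exists_lattice_convolution_le {τ σ A H C h ε ρ : ℝ} (hσ : 1 < σ) (hτ : 0 < τ) (hA : 0 < A)
    (hH : 1 ≤ H) (hC : 0 < C) (hh : 0 < h) (hε : 0 < ε) (hε2 : ε ≤ 1 / 2) (hρ : 1 ≤ ρ)
    {F : Rd d → ℂ} {m : ℕ} (hF : ∀ ξ, ‖F ξ‖ ≤ C * (1 + ‖ξ‖) ^ m) :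
    ∃ D h' : ℝ, 0 < D ∧ 0 < h' ∧ ∀ c : (Fin d → ℤ) → ℂ,
      (∀ (n : ℕ) (k : Fin d → ℤ), ‖latticePoint k‖ ^ n * ‖c k‖ ≤
        A * (H ^ ((n : ℝ) ^ σ) * defSeq τ σ n)) →
      ∀ ξ : Rd d, 0 < ‖ξ‖ → ∀ N : ℕ, 1 ≤ N →
        (∀ η, ‖η‖ ≤ ε * ‖ξ‖ → ‖F (ξ - η)‖ ≤
          C * (h ^ ((N : ℝ) ^ σ) * defSeq τ σ N / ‖ξ - η‖ ^ N)) →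
        ∀ k, ‖c k * F (ξ - (4 * ρ)⁻¹ • latticePoint k)‖ ≤
          D * (h' ^ ((N : ℝ) ^ σ) * defSeq τ σ N / ‖ξ‖ ^ N) * latticeWeight k := by
  -- Of the extra powers of `‖k‖`, `m` compensate the growth of `F` and `d + 1` make the sum over
  -- the lattice converge.
  obtain ⟨H', hH', hshift⟩ := exists_shift_le hσ hτ (m + (d + 1)) hH
  set Q : ℕ → ℝ := fun n => A * (H ^ ((n : ℝ) ^ σ) * defSeq τ σ n) with hQ
  have hD := fun n => defSeq_pos (τ := τ) hσ n
  have hQpos : ∀ n, 0 < Q n := fun n => by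
    have := hD n
    positivity
  set D₁ := 2 ^ (d + 1) * (Q 0 + Q (d + 1)) * C with hD₁
  set D₂ := C * (1 + 1 / ε) ^ m * (2 ^ (m + (d + 1)) * (A + A)) with hD₂
  have hD₁pos : 0 < D₁ := by
    have := hQpos 0
    have := hQpos (d + 1)
    positivity
  set h₁ := 2 * max 1 h with hh₁
  set h₂ := ε⁻¹ * max H H' with hh₂
  have hmax1 : 1 ≤ max 1 h := le_max_left _ _
  have hmaxH : 1 ≤ max H H' := hH.trans (le_max_left _ _)
  refine ⟨max D₁ D₂, max h₁ h₂, lt_max_of_lt_left hD₁pos, lt_max_of_lt_left (by positivity),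
    fun c hc ξ hξ N hN hcone k => ?_⟩
  have hNσ := le_natCast_rpow hσ N
  have hpow : ∀ a : ℝ, 1 ≤ a → a ^ N ≤ a ^ ((N : ℝ) ^ σ) := fun a ha => by
    rw [← Real.rpow_natCast]
    exact Real.rpow_le_rpow_of_exponent_le ha hNσ
  have hDN := hD N
  set κ := (4 * ρ)⁻¹ • latticePoint k with hκ
  have hκn : ‖κ‖ ≤ ‖latticePoint k‖ := by
    rw [hκ, norm_smul, norm_inv, Real.norm_of_nonneg (by positivity)]
    exact mul_le_of_le_one_left (norm_nonneg _) (inv_le_one_of_one_le₀ (by linarith))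
  have hw := latticeWeight_pos k
  rw [norm_mul]
  -- In the near region the cone estimate applies and `‖ξ - κ‖ ≥ ‖ξ‖/2`; in the far region the decay
  -- of `c k` does all the work.
  by_cases hcase : ‖κ‖ ≤ ε * ‖ξ‖
  · have h1 : ‖c k‖ ≤ 2 ^ (d + 1) * (Q 0 + Q (d + 1)) * latticeWeight k := by
      have h0 := hc 0 k
      rw [pow_zero, one_mul] at h0
      have := one_add_pow_mul_le (norm_nonneg _) (norm_nonneg _) (d + 1) h0 (hc (d + 1) k)
      rw [latticeWeight, ← div_eq_mul_inv, le_div_iff₀ (by positivity), mul_comm]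
      exact this
    have h2 : ‖ξ‖ / 2 ≤ ‖ξ - κ‖ := by
      have := norm_sub_norm_le ξ κ
      nlinarith
    have h3 : ‖F (ξ - κ)‖ ≤ C * (h₁ ^ ((N : ℝ) ^ σ) * defSeq τ σ N / ‖ξ‖ ^ N) := by
      refine (hcone κ hcase).trans ?_
      gcongr C * ?_
      calc h ^ ((N : ℝ) ^ σ) * defSeq τ σ N / ‖ξ - κ‖ ^ N ≤
          (max 1 h) ^ ((N : ℝ) ^ σ) * defSeq τ σ N / (‖ξ‖ / 2) ^ N := by
            gcongr
            exact le_max_right _ _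
        _ = 2 ^ N * (max 1 h) ^ ((N : ℝ) ^ σ) * defSeq τ σ N / ‖ξ‖ ^ N := by
            rw [div_pow]; field_simp
        _ ≤ 2 ^ ((N : ℝ) ^ σ) * (max 1 h) ^ ((N : ℝ) ^ σ) * defSeq τ σ N / ‖ξ‖ ^ N := by
            gcongr
            exact hpow 2 (by norm_num)
        _ = _ := by rw [hh₁, Real.mul_rpow (by norm_num) (by positivity)]
    calc ‖c k‖ * ‖F (ξ - κ)‖ ≤ (2 ^ (d + 1) * (Q 0 + Q (d + 1)) * latticeWeight k) *
          (C * (h₁ ^ ((N : ℝ) ^ σ) * defSeq τ σ N / ‖ξ‖ ^ N)) := by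
          have := hQpos 0
          have := hQpos (d + 1)
          gcongr
      _ = D₁ * (h₁ ^ ((N : ℝ) ^ σ) * defSeq τ σ N / ‖ξ‖ ^ N) * latticeWeight k := by
          rw [hD₁]; ring
      _ ≤ _ := by
          gcongr
          · exact le_max_left _ _
          · exact le_max_left _ _
  · push Not at hcase
    set K := ‖latticePoint k‖ with hK
    have hK0 : 0 ≤ K := norm_nonneg _
    have hξK : ‖ξ‖ ≤ ε⁻¹ * K := by
      rw [le_inv_mul_iff₀ hε]
      exact hcase.le.trans hκn
    have h1 : ‖F (ξ - κ)‖ ≤ C * ((1 + 1 / ε) * (1 + K)) ^ m := by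
      refine (hF _).trans ?_
      gcongr
      have := norm_sub_le ξ κ
      have h2 : 0 < 1 / ε := by positivity
      have h3 : ε⁻¹ * K = 1 / ε * K := by rw [one_div]
      nlinarith
    have h2 : (1 + K) ^ (m + (d + 1)) * (K ^ N * ‖c k‖) ≤
        2 ^ (m + (d + 1)) * ((A + A) * ((max H H') ^ ((N : ℝ) ^ σ) * defSeq τ σ N)) := by
      have h3 : K ^ (m + (d + 1)) * (K ^ N * ‖c k‖) ≤ Q (N + (m + (d + 1))) := by
        rw [← mul_assoc, ← pow_add, add_comm _ N]
        exact hc _ k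
      refine (one_add_pow_mul_le hK0 (by positivity) _ (hc N k) h3).trans ?_
      gcongr
      rw [add_mul]
      have h5 := hshift N hN
      gcongr
      · exact le_max_left _ _
      · refine mul_le_mul_of_nonneg_left (h5.trans ?_) hA.le
        gcongr
        exact le_max_right _ _
    -- Inserting this factor converts `N` powers of `‖k‖` into the required `‖ξ‖^{-N}`.
    have h4 : 1 ≤ (ε⁻¹ * K) ^ N / ‖ξ‖ ^ N := by
      rw [one_le_div (by positivity)]
      gcongr
    have h6 : (1 + K) ^ m = (1 + K) ^ (m + (d + 1)) * latticeWeight k := by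
      rw [latticeWeight, ← hK, pow_add]
      field_simp
    have h7 : (1 : ℝ) ≤ ε⁻¹ := by
      rw [one_le_inv₀ hε]; linarith
    calc ‖c k‖ * ‖F (ξ - κ)‖ ≤ ‖c k‖ * (C * ((1 + 1 / ε) * (1 + K)) ^ m) * 1 := by
          rw [mul_one]; gcongr
      _ ≤ ‖c k‖ * (C * ((1 + 1 / ε) * (1 + K)) ^ m) * ((ε⁻¹ * K) ^ N / ‖ξ‖ ^ N) := by gcongr
      _ = C * (1 + 1 / ε) ^ m * (ε⁻¹ ^ N / ‖ξ‖ ^ N) *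
            ((1 + K) ^ (m + (d + 1)) * (K ^ N * ‖c k‖)) * latticeWeight k := by
          rw [mul_pow, mul_pow, h6]; ring
      _ ≤ C * (1 + 1 / ε) ^ m * (ε⁻¹ ^ ((N : ℝ) ^ σ) / ‖ξ‖ ^ N) *
            (2 ^ (m + (d + 1)) * ((A + A) * ((max H H') ^ ((N : ℝ) ^ σ) * defSeq τ σ N))) *
            latticeWeight k := by
          have := hpow ε⁻¹ h7
          gcongr
      _ = D₂ * (h₂ ^ ((N : ℝ) ^ σ) * defSeq τ σ N / ‖ξ‖ ^ N) * latticeWeight k := by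
          rw [hD₂, hh₂, Real.mul_rpow (by positivity) (by positivity)]; ring
      _ ≤ _ := by
          gcongr
          · exact le_max_right _ _
          · exact le_max_right _ _

theorem exists_stft_le_of_notMem_waveFrontSet {τ σ : ℝ} (hσ : 1 < σ) (hτ : 0 < τ) (u : Distr d)
    {x₀ ξ₀ : Rd d} (hξ₀ : ξ₀ ≠ 0) (hWF : (x₀, ξ₀) ∉ waveFrontSet τ σ u) :
    ∃ (Γ K : Set (Rd d)) (g : TestFun d), IsConicNhd Γ ξ₀ ∧ IsCompact K ∧ K ∈ 𝓝 x₀ ∧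
      IsWindow τ σ x₀ K g ∧ ∃ h D : ℝ, 0 < h ∧ 0 < D ∧ ∀ x ∈ K, ∀ ξ ∈ Γ, ∀ N : ℕ, 1 ≤ N →
        ‖stft g u x ξ‖ ≤ D * (h ^ ((N : ℝ) ^ σ) * defSeq τ σ N / ‖ξ‖ ^ N) := by
  have hd : 0 < d := by
    rcases Nat.eq_zero_or_pos d with rfl | hd
    · exact absurd (Subsingleton.elim _ _) hξ₀
    · exact hd
  simp only [waveFrontSet, mem_ofPred_eq, not_and, not_not] at hWF
  obtain ⟨Γ, φ, hΓ, hφ, hφ₀, h, hh, C, hC, hdec⟩ := hWF hξ₀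
  obtain ⟨Γ₁, ε, hΓ₁, hε, hε2, hshr⟩ := exists_conic_shrink hξ₀ hΓ
  have hnhd : {x | φ x ≠ 0} ∈ 𝓝 x₀ := φ.continuous.continuousAt.eventually_ne hφ₀
  obtain ⟨r', hr', hball⟩ := Metric.nhds_basis_closedBall.mem_iff.1 hnhd
  -- Halving leaves room for translation: for `x` within `r` of `x₀`, the support of `g(· - x)`
  -- stays where `φ ≠ 0`.
  set r := r' / 2 with hr
  have hrpos : 0 < r := by positivity
  have hr2 : 2 * r = r' := by rw [hr]; ring
  obtain ⟨g, hg, hgs, hg0, hgreal⟩ := exists_bump hσ hτ hrpos d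
  refine ⟨Γ₁, Metric.closedBall x₀ r, g, hΓ₁, isCompact_closedBall _ _,
    Metric.closedBall_mem_nhds _ hrpos, ⟨hg, ?_, hg0⟩, ?_⟩
  · rw [hgs]
    ext y
    simp [dist_eq_norm]
  obtain ⟨A, H, hA, hH, hdiv⟩ := exists_dirDeriv_div_le hσ hτ hφ hg hgs.subset
    (x₀ := x₀) (fun x hx => hball (by rwa [hr2] at hx))
  obtain ⟨R, hR⟩ := φ.hasCompactSupport.isBounded.subset_closedBall (0 : Rd d)
  set ρ := max 1 (max R (‖x₀‖ + 2 * r)) with hρ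
  have hρ1 : 1 ≤ ρ := le_max_left _ _
  have hφρ : tsupport φ ⊆ Metric.closedBall 0 ρ :=
    hR.trans (Metric.closedBall_subset_closedBall ((le_max_left _ _).trans (le_max_right _ _)))
  have hxρ : Metric.closedBall x₀ (2 * r) ⊆ Metric.closedBall 0 ρ := by
    refine Metric.closedBall_subset_closedBall' ?_
    rw [dist_zero_right, add_comm]
    exact (le_max_right _ _).trans (le_max_right _ _)
  obtain ⟨m, C', hC', hpoly⟩ := exists_norm_fourierCutoff_le u φ
  set V := MeasureTheory.volume.real (Metric.closedBall (0 : Rd d) 1)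
  have hVpos : 0 < V := by
    refine ENNReal.toReal_pos (Metric.measure_closedBall_pos _ _ one_pos).ne'
      MeasureTheory.measure_closedBall_lt_top.ne
  have hd1 : (1 : ℝ) ≤ d := by exact_mod_cast hd
  have hH' : 1 ≤ d * (4 * ρ) * H :=
    one_le_mul_of_one_le_of_one_le (one_le_mul_of_one_le_of_one_le hd1 (by linarith)) hH
  obtain ⟨D, h', hD, hh', hconv⟩ := exists_lattice_convolution_le (d := d) (τ := τ) (C := max C C')
    (F := fourierCutoff u φ) (m := m) hσ hτ (show 0 < V * A by positivity) hH'
    (lt_max_of_lt_left hC) hh hε hε2 hρ1 (fun ξ => (hpoly ξ).trans (by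
      gcongr
      exact le_max_right _ _))
  have hW : 0 < ∑' k : Fin d → ℤ, latticeWeight k :=
    summable_latticeWeight.tsum_pos (fun k => (latticeWeight_pos k).le) 0 (latticeWeight_pos 0)
  refine ⟨h', D * ∑' k : Fin d → ℤ, latticeWeight k, hh', by positivity,
    fun x hx ξ hξ N hN => ?_⟩
  obtain ⟨hχs, hχc, hχm, hχb⟩ := hdiv x hx
  obtain ⟨c, hc, hcsum⟩ := exists_fourier_expansion hσ hd hρ1 hA hH hχc (hχs.trans hxρ) hχb
  have hsum := hasSum_stft u φ g x ξ hρ1 hφρ (c := c) (fun t => (hχm t).trans (hgreal _).symm)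
    (fun s => ⟨_, fun k => one_add_pow_mul_le (norm_nonneg _) (norm_nonneg _) s
      (by simpa using hc 0 k) (hc s k)⟩) hcsum
  have hξpos : 0 < ‖ξ‖ := norm_pos_iff.2 fun h0 => hΓ₁.2.1 (h0 ▸ hξ)
  have hterm := hconv c hc ξ hξpos N hN (fun η hη => (hdec N hN _ (hshr ξ hξ η hη)).trans (by
    have := defSeq_pos (τ := τ) hσ N
    gcongr
    exact le_max_left _ _))
  have hbd := hsum.summable.norm.tsum_le_tsum hterm (summable_latticeWeight.mul_left _)
  rw [tsum_mul_left] at hbd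
  rw [← hsum.tsum_eq]
  refine (norm_tsum_le_tsum_norm hsum.summable.norm).trans (hbd.trans (le_of_eq ?_))
  ring

theorem stft_eq_fourierCutoff (g : TestFun d) (u : Distr d) (x ξ : Rd d) :
    stft g u x ξ = fourierCutoff u (conjugate (translation x g)) ξ := by
  unfold stft fourierCutoff
  congr 1
  ext t
  change (starRingEnd ℂ) (Complex.exp (2 * Real.pi * Complex.I * ((inner ℝ t ξ : ℝ) : ℂ)) *
    g (t - x)) = Complex.exp (2 * Real.pi * Complex.I * ((inner ℝ t (-ξ) : ℝ) : ℂ)) *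
    (starRingEnd ℂ) (g (t - x))
  rw [map_mul, conj_exp_inner]

theorem IsExtGevrey.conjugate_translation {τ σ : ℝ} {g : TestFun d} (hg : IsExtGevrey τ σ g)
    (x : Rd d) : IsExtGevrey τ σ (conjugate (translation x g)) := by
  refine ⟨(conjugate (translation x g)).contDiff, fun K hK => ?_⟩
  obtain ⟨h, hh, C, hC, hb⟩ := hg.2 ((fun y => y - x) '' K) (hK.image (by fun_prop))
  refine ⟨h, hh, C, hC, fun y hy n i => ?_⟩
  have hsm : ContDiff ℝ ∞ (fun t => g (t - x)) := g.contDiff.comp (contDiff_id.sub contDiff_const)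
  have h1 := (Complex.conjCLE : ℂ →L[ℝ] ℂ).iteratedFDeriv_comp_left (f := fun t => g (t - x))
    (x := y) hsm.contDiffAt (i := n) (by exact_mod_cast le_top)
  have h2 : ((conjugate (translation x g) : TestFun d) : Rd d → ℂ) =
    (Complex.conjCLE : ℂ →L[ℝ] ℂ) ∘ fun t => g (t - x) := rfl
  rw [h2, h1, iteratedFDeriv_comp_sub]
  have h3 := hb (y - x) ⟨y, hy, rfl⟩ n i
  simpa using h3

/-- Only the slice `x = x₀` is needed: there the transform is `(ψ u)^` with `ψ = conj g(· - x₀)`,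
and `ψ(x₀) = conj g(0) ≠ 0`. -/
theorem notMem_waveFrontSet_of_stft_le {τ τ₁ σ : ℝ} (hσ : 1 < σ) (hτ₁ : 0 < τ₁) (hτ : τ₁ < τ)
    (u : Distr d) {x₀ ξ₀ : Rd d} {Γ : Set (Rd d)} {g : TestFun d} (hΓ : IsConicNhd Γ ξ₀)
    (hg : IsExtGevrey τ σ g) (hg0 : g 0 ≠ 0) {C : ℝ} (hC : 0 < C)
    (hb : ∀ ξ ∈ Γ, 1 < ‖ξ‖ → ‖stft g u x₀ ξ‖ ≤ C * lambertDecay (decayConst σ) τ₁ σ ‖ξ‖) :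
    (x₀, ξ₀) ∉ waveFrontSet τ σ u := by
  simp only [waveFrontSet, mem_ofPred_eq, not_and, not_not]
  intro _
  obtain ⟨h, hh, hdec⟩ := exists_lambertDecay_le hσ hτ₁
  obtain ⟨m, C', hC', hpoly⟩ := exists_norm_fourierCutoff_le u (conjugate (translation x₀ g))
  refine ⟨Γ, conjugate (translation x₀ g), hΓ, hg.conjugate_translation x₀, ?_, h, by linarith,
    max C (C' * 2 ^ m), lt_max_of_lt_left hC, fun N hN ξ hξ => ?_⟩
  · change (starRingEnd ℂ) (g (x₀ - x₀)) ≠ 0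
    rw [sub_self]
    simpa using hg0
  have hDpos := defSeq_pos (τ := τ) hσ N
  have hDpos₁ := defSeq_pos (τ := τ₁) hσ N
  have hξpos : 0 < ‖ξ‖ := norm_pos_iff.2 fun h0 => hΓ.2.1 (h0 ▸ hξ)
  rcases lt_or_ge 1 ‖ξ‖ with h1 | h1
  · rw [← stft_eq_fourierCutoff]
    calc _ ≤ C * lambertDecay (decayConst σ) τ₁ σ ‖ξ‖ := hb ξ hξ h1
      _ ≤ C * (h ^ ((N : ℝ) ^ σ) * defSeq τ₁ σ N / ‖ξ‖ ^ N) := by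
          gcongr
          exact hdec N hN _ h1
      _ ≤ _ := by
          have := defSeq_mono_left (σ := σ) hτ.le hN
          gcongr
          exact le_max_left _ _
  -- For `‖ξ‖ ≤ 1` the decay hypothesis says nothing, but the required bound is then at least a
  -- constant multiple of 1.
  · have hN' : (1 : ℝ) ≤ N := by exact_mod_cast hN
    have h2 : 1 ≤ h ^ ((N : ℝ) ^ σ) * defSeq τ σ N / ‖ξ‖ ^ N := by
      rw [one_le_div (by positivity)]
      calc ‖ξ‖ ^ N ≤ 1 := pow_le_one₀ (norm_nonneg _) h1
        _ ≤ _ := by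
          refine one_le_mul_of_one_le_of_one_le (Real.one_le_rpow hh (by positivity)) ?_
          have hτ0 : 0 < τ := hτ₁.trans hτ
          exact Real.one_le_rpow hN' (by positivity)
    calc _ ≤ C' * (1 + ‖ξ‖) ^ m := hpoly ξ
      _ ≤ C' * 2 ^ m := by gcongr; linarith
      _ ≤ max C (C' * 2 ^ m) * 1 := by rw [mul_one]; exact le_max_right _ _
      _ ≤ _ := by gcongr

end WaveFront

end ExtGevrey

end

theorem corollary4p6 (σ : ℝ) (hσ : 1 < σ) :
    ∃ c : ℝ, 0 < c ∧
      ∀ (d : ℕ) (τ : ℝ), 0 < τ → ∀ (u : ExtGevrey.Distr d) (x₀ ξ₀ : ExtGevrey.Rd d), ξ₀ ≠ 0 →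
        ((x₀, ξ₀) ∉ ExtGevrey.waveFrontSet τ σ u →
          ∃ (Γ K : Set (ExtGevrey.Rd d)) (g : ExtGevrey.TestFun d),
            ExtGevrey.IsConicNhd Γ ξ₀ ∧ IsCompact K ∧ K ∈ 𝓝 x₀ ∧ ExtGevrey.IsWindow τ σ x₀ K g ∧
            ∀ τ₂ : ℝ, τ < τ₂ → ∃ C : ℝ, 0 < C ∧ ∀ x ∈ K, ∀ ξ ∈ Γ, 1 < ‖ξ‖ →
              ‖ExtGevrey.stft g u x ξ‖ ≤ C * ExtGevrey.lambertDecay c τ₂ σ ‖ξ‖) ∧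
        ((∃ (Γ K : Set (ExtGevrey.Rd d)) (g : ExtGevrey.TestFun d),
            ExtGevrey.IsConicNhd Γ ξ₀ ∧ IsCompact K ∧ K ∈ 𝓝 x₀ ∧ ExtGevrey.IsWindow τ σ x₀ K g ∧
            ∃ τ₁ : ℝ, 0 < τ₁ ∧ τ₁ < τ ∧ ∃ C : ℝ, 0 < C ∧ ∀ x ∈ K, ∀ ξ ∈ Γ, 1 < ‖ξ‖ →
              ‖ExtGevrey.stft g u x ξ‖ ≤ C * ExtGevrey.lambertDecay c τ₁ σ ‖ξ‖) →
          (x₀, ξ₀) ∉ ExtGevrey.waveFrontSet τ σ u) := by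
  refine ⟨ExtGevrey.decayConst σ, ExtGevrey.decayConst_pos hσ, fun d τ hτ u x₀ ξ₀ hξ₀ => ⟨?_, ?_⟩⟩
  · intro hWF
    obtain ⟨Γ, K, g, hΓ, hK, hKn, hg, h, D, hh, hD, hb⟩ :=
      ExtGevrey.exists_stft_le_of_notMem_waveFrontSet hσ hτ u hξ₀ hWF
    refine ⟨Γ, K, g, hΓ, hK, hKn, hg, fun τ₂ hτ₂ => ?_⟩
    -- The bounds for all `N` do not involve `τ₂`, so `Γ`, `K` and `g` are fixed beforehand and only
    -- `C` depends on `τ₂`.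
    obtain ⟨C, hC, hdec⟩ := ExtGevrey.exists_le_lambertDecay hσ hτ hτ₂ hh
    refine ⟨D * C, by positivity, fun x hx ξ hξ hξ1 => ?_⟩
    obtain ⟨N, hN, hle⟩ := hdec ‖ξ‖ hξ1
    refine (hb x hx ξ hξ N hN).trans ?_
    rw [mul_assoc]
    gcongr
  · rintro ⟨Γ, K, g, hΓ, -, hKn, hg, τ₁, hτ₁, hττ, C, hC, hb⟩
    exact ExtGevrey.notMem_waveFrontSet_of_stft_le hσ hτ₁ hττ u hΓ hg.1 hg.2.2 hC
      (hb x₀ (mem_of_mem_nhds hKn))
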